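/- Let $U\subset\mathbb R^2$ be a nonempty connected open set and $\phi\in C^\infty(U)$, and equip $U$ with the Poisson bivector $\alpha^{ij}=\epsilon^{ij}\phi$ ($\epsilon^{12}=1$). Assume that every symplectic leaf of $(U,\alpha)$ is simply connected. Let $I=[0,1]$ and write $C^1_0(I,\mathbb R^2)$ for the $C^1$ maps $I\to\mathbb R^2$ vanishing at $0$ and $1$. Let $\tilde{\mathcal C}$ be the set of $(X,\eta)\in C^1(I,U)\times C^0(I,\mathbb R^2)$ with $$(X^1)'+\phi(X)\eta_2=0,\qquad (X^2)'-\phi(X)\eta_1=0,$$ and let $\tilde{\mathcal G}$ be its quotient by the symmetries generated by $$\delta X^1=-\phi\beta_2,\quad \delta X^2=\phi\beta_1,\quad \delta\eta_i=\beta_i'+\partial_i\phi\,(\eta_1\beta_2-\eta_2\beta_1),\qquad \beta\in C^1_0(I,\mathbb R^2).$$ Let $\tilde{\tilde{\mathcal C}}$ be the set of $(X,E)\in C^1(I,U)\times C^0(I,\mathbb R^2)$ with, for $\phi_0=\phi(X(0))$, $$(X^1)'+\phi_0E_2=0,\qquad (X^2)'-\phi_0E_1=0,\qquad 1+\int_0^u(\partial_2\phi(X)E_1-\partial_1\phi(X)E_2)\,dv>0\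 \ \text{for all }u\in I,$$ and let $\tilde{\tilde{\mathcal G}}$ be its quotient by the symmetries generated by $$\delta X^1=-\phi_0e_2,\quad \delta X^2=\phi_0e_1,\quad \delta E_i=e_i',\qquad e\in C^1_0(I,\mathbb R^2).$$ (In both cases the quotient is by the equivalence relation generated by: two solutions are joined by a $C^1$ curve of solutions whose velocity at each time $s$ is the infinitesimal symmetry with a generator depending continuously on $s$.) For $(x,\pi)\in U\times\mathbb R^2$ put $x_f=(x^1-\phi(x)\pi_2,\;x^2+\phi(x)\pi_1)$ and, if $x_f\in U$, let $h(x,\pi)=\phi(x_f)/\phi(x)$ if $\phi(x)\neq0$ and $h(x,\pi)=1-\pi_2\partial_1\phi(x)+\pi_1\partial_2\phi(x)$ if $\phi(x)=0$. Let $\mathcal G$ be the connected component containing $U\times\{0\}$ of $\{(x,\pi)\in U\times\mathbb R^2: x_f\in U,\ h(x,\pi)>0\}$. Then $\mathcal G$ is open in $\mathbb R^4$; $\tilde{\mathcal C}$ and $\tilde{\tilde{\mathcal C}}$ are smooth embedded Banach submanifolds of $C^1(I,\mathbb R^2)\times C^0(I,\mathbb R^2)$; the quotients $\tilde{\mathcal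 G}$ and $\tilde{\tilde{\mathcal G}}$ (with the quotient topology) carry smooth $4$-manifold structures for which the projections $\tilde{\mathcal C}\to\tilde{\mathcal G}$ and $\tilde{\tilde{\mathcal C}}\to\tilde{\tilde{\mathcal G}}$ are submersions; and both quotients are diffeomorphic to $\mathcal G$, through $$[(X,\eta)]\mapsto\Big(X(0),\int_0^1H\eta\,du\Big),\quad H(u)=\exp\int_0^u(\partial_2\phi(X)\eta_1-\partial_1\phi(X)\eta_2)\,dv,\qquad\text{and}\qquad [(X,E)]\mapsto\Big(X(0),\int_0^1E\,du\Big)$$ respectively. -/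

import Mathlib

open scoped Manifold ContDiff

noncomputable section

namespace PoissonSigma

/-- The coordinate plane `ℝ²`. (All notions below only use its topological vector space
structure.) -/
abbrev Plane : Type := ℝ × ℝ

/-- The space `ℝ⁴` of pairs `(x, π)`. -/
abbrev Phase : Type := Plane × Plane

/-- The Banach space `C⁰(I, ℝ²)`, `I = [0,1]`, with the supremum norm. -/
abbrev C0 : Type := C(unitInterval, Plane)

/-- The space `C¹(I, ℝ²)`, realised as the space of pairs `(f, g)` of continuous maps such that
`g` is the derivative of `f` (one-sided at the endpoints); its norm is
`max (‖f‖_∞) (‖f'‖_∞)`. -/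
def C1 : Submodule ℝ (C0 × C0) where
  carrier := {p | ∀ u : unitInterval,
    HasDerivWithinAt (Set.IccExtend zero_le_one p.1) (p.2 u) (Set.Icc 0 1) (u : ℝ)}
  add_mem' := fun {_ _} ha hb u => (ha u).add (hb u)
  zero_mem' := fun u => hasDerivWithinAt_const (u : ℝ) (Set.Icc 0 1) (0 : Plane)
  smul_mem' := fun c _ ha u => (ha u).const_smul c

/-- The map underlying an element of `C¹(I, ℝ²)`. -/
def path (X : C1) : C0 := X.1.1

/-- The derivative of an element of `C¹(I, ℝ²)`. -/
def dpath (X : C1) : C0 := X.1.2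

/-- The Banach space `C¹(I, ℝ²) × C⁰(I, ℝ²)`. -/
abbrev Fields : Type := C1 × C0

/-- `∂₁φ`. -/
def d1 (φ : Plane → ℝ) (x : Plane) : ℝ := fderiv ℝ φ x (1, 0)

/-- `∂₂φ`. -/
def d2 (φ : Plane → ℝ) (x : Plane) : ℝ := fderiv ℝ φ x (0, 1)

/-! ### Symplectic leaves -/

/-- The Hamiltonian vector field `αⁱʲ ∂ⱼf` of `f` for `αⁱʲ = εⁱʲ φ`, `ε¹² = 1`. -/
def hamiltonianField (φ f : Plane → ℝ) (x : Plane) : Plane :=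
  (φ x * d2 f x, -(φ x * d1 f x))

/-- `y` is reached from `x` along an integral curve, contained in `U`, of the Hamiltonian vector
field of a smooth function on `U`. -/
def HamiltonianArc (U : Set Plane) (φ : Plane → ℝ) (x y : Plane) : Prop :=
  ∃ (f : Plane → ℝ) (γ : ℝ → Plane), ContDiffOn ℝ ∞ f U ∧ γ 0 = x ∧ γ 1 = y ∧
    ∀ t ∈ Set.Icc (0 : ℝ) 1, γ t ∈ U ∧
      HasDerivWithinAt γ (hamiltonianField φ f (γ t)) (Set.Icc 0 1) t

/-- The symplectic leaf of `(U, ε φ)` through `x`: the set of points that can be joined to `x`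
by finitely many integral curves of Hamiltonian vector fields. In dimension two a leaf is
either a point or an open subset of `U`, so that its manifold topology is the one induced
from the plane. -/
def symplecticLeaf (U : Set Plane) (φ : Plane → ℝ) (x : Plane) : Set Plane :=
  {y | Relation.ReflTransGen (HamiltonianArc U φ) x y}

/-! ### Solutions of the Gauss law and gauge symmetries -/

/-- The pairs `(X, η) ∈ C¹(I, U) × C⁰(I, ℝ²)` that satisfy
`(X¹)' + φ(X) η₂ = 0`, `(X²)' - φ(X) η₁ = 0`. -/
def gaussSolutions (U : Set Plane) (φ : Plane → ℝ) : Set Fields :=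
  {p | ∀ u : unitInterval, path p.1 u ∈ U ∧
    (dpath p.1 u).1 + φ (path p.1 u) * (p.2 u).2 = 0 ∧
    (dpath p.1 u).2 - φ (path p.1 u) * (p.2 u).1 = 0}

/-- `v = (δX, δη)` is the infinitesimal symmetry with generator `β` at `(X, η)`:
`δX¹ = -φ β₂`, `δX² = φ β₁`, `δηᵢ = βᵢ' + ∂ᵢφ (η₁ β₂ - η₂ β₁)`. -/
def IsGaussVariation (φ : Plane → ℝ) (p : Fields) (β : C1) (v : Fields) : Prop :=
  ∀ u : unitInterval,
    (path v.1 u).1 = -(φ (path p.1 u) * (path β u).2) ∧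
    (path v.1 u).2 = φ (path p.1 u) * (path β u).1 ∧
    (v.2 u).1 = (dpath β u).1 +
      d1 φ (path p.1 u) * ((p.2 u).1 * (path β u).2 - (p.2 u).2 * (path β u).1) ∧
    (v.2 u).2 = (dpath β u).2 +
      d2 φ (path p.1 u) * ((p.2 u).1 * (path β u).2 - (p.2 u).2 * (path β u).1)

/-- `T = ∂₂φ η₁ - ∂₁φ η₂` along `X`, as a function of `u ∈ [0,1]`. For a pair `(X, E)` in place of
`(X, η)` this is the function `∂₂φ E₁ - ∂₁φ E₂`. -/
def rate (φ : Plane → ℝ) (p : Fields) (u : unitInterval) : ℝ :=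
  d2 φ (path p.1 u) * (p.2 u).1 - d1 φ (path p.1 u) * (p.2 u).2

/-- `H(u) = exp ∫₀ᵘ T` for a pair `(X, η)`. -/
def expH (φ : Plane → ℝ) (p : Fields) (u : ℝ) : ℝ :=
  Real.exp (∫ v in (0 : ℝ)..u, Set.IccExtend zero_le_one (rate φ p) v)

/-- `H(u) = 1 + ∫₀ᵘ (∂₂φ E₁ - ∂₁φ E₂)` for a pair `(X, E)`. -/
def linH (φ : Plane → ℝ) (p : Fields) (u : ℝ) : ℝ :=
  1 + ∫ v in (0 : ℝ)..u, Set.IccExtend zero_le_one (rate φ p) v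

/-- The pairs `(X, E) ∈ C¹(I, U) × C⁰(I, ℝ²)` that satisfy
`(X¹)' + φ(X(0)) E₂ = 0`, `(X²)' - φ(X(0)) E₁ = 0` and `H(u) > 0` for all `u ∈ I`. -/
def modifiedSolutions (U : Set Plane) (φ : Plane → ℝ) : Set Fields :=
  {p | ∀ u : unitInterval, path p.1 u ∈ U ∧
    (dpath p.1 u).1 + φ (path p.1 0) * (p.2 u).2 = 0 ∧
    (dpath p.1 u).2 - φ (path p.1 0) * (p.2 u).1 = 0 ∧
    0 < linH φ p u}

/-- `v = (δX, δE)` is the infinitesimal symmetry with generator `e` at `(X, E)`: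
`δX¹ = -φ(X(0)) e₂`, `δX² = φ(X(0)) e₁`, `δEᵢ = eᵢ'`. -/
def IsModifiedVariation (φ : Plane → ℝ) (p : Fields) (e : C1) (v : Fields) : Prop :=
  ∀ u : unitInterval,
    (path v.1 u).1 = -(φ (path p.1 0) * (path e u).2) ∧
    (path v.1 u).2 = φ (path p.1 0) * (path e u).1 ∧
    v.2 u = dpath e u

/-- Given a set `S` of fields and infinitesimal symmetries `δ p β v` (read: `v` is the variation
of `p` with generator `β`), two elements of `S` are related if they are the endpoints of a `C¹`
curve in `S` whose velocity is at each time `s` the infinitesimal symmetry with some generator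
`β s ∈ C¹₀(I, ℝ²)` (`β s` vanishes at both endpoints of `I`), continuous in `s`. -/
def SymmetryArc (S : Set Fields) (δ : Fields → C1 → Fields → Prop) (p q : S) : Prop :=
  ∃ (γ : ℝ → Fields) (β : ℝ → C1), γ 0 = p ∧ γ 1 = q ∧ ContinuousOn β (Set.Icc 0 1) ∧
    ∀ s ∈ Set.Icc (0 : ℝ) 1, γ s ∈ S ∧ path (β s) 0 = 0 ∧ path (β s) 1 = 0 ∧
      ∃ v : Fields, HasDerivWithinAt γ v (Set.Icc 0 1) s ∧ δ (γ s) (β s) v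

/-- The quotient of `S` by the symmetries, that is by the equivalence relation generated by
`SymmetryArc`, with the quotient topology. -/
abbrev PhaseSpace (S : Set Fields) (δ : Fields → C1 → Fields → Prop) : Type :=
  Quot (SymmetryArc S δ)

/-! ### The finite-dimensional model -/

/-- `x_fⁱ = xⁱ - φ(x) εⁱʲ πⱼ`. -/
def xf (φ : Plane → ℝ) (p : Phase) : Plane :=
  (p.1.1 - φ p.1 * p.2.2, p.1.2 + φ p.1 * p.2.1)

open Classical in
/-- `h = φ(x_f) / φ(x)` if `φ(x) ≠ 0`, and `h = 1 - π₂ ∂₁φ(x) + π₁ ∂₂φ(x)` if `φ(x) = 0`. -/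
def hFun (φ : Plane → ℝ) (p : Phase) : ℝ :=
  if φ p.1 = 0 then 1 - p.2.2 * d1 φ p.1 + p.2.1 * d2 φ p.1 else φ (xf φ p) / φ p.1

/-- `{(x, π) ∈ U × ℝ² | x_f ∈ U, h > 0}`. -/
def positiveSet (U : Set Plane) (φ : Plane → ℝ) : Set Phase :=
  {p | p.1 ∈ U ∧ xf φ p ∈ U ∧ 0 < hFun φ p}

/-- The set of all points in the connected component in `positiveSet U φ` of some point of
`U × {0}`. For connected `U` this is a single connected component. -/
def calG (U : Set Plane) (φ : Plane → ℝ) : Set Phase :=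
  ⋃ x ∈ U, connectedComponentIn (positiveSet U φ) (x, 0)

/-! ### Smooth structures -/

/-- The quotient of `S` by the symmetries `δ` is a smooth 4-manifold, diffeomorphic to the open set
`G` of `ℝ⁴` through the map induced by `F`. In detail: `S` is a smooth Banach manifold, smoothly
embedded in `C¹(I, ℝ²) × C⁰(I, ℝ²)`; the quotient has a smooth structure (compatible with the
quotient topology) for which the projection is a submersion, hence which is the quotient smooth
structure; and there is a diffeomorphism of the quotient onto `G` that maps the class of `p` to
`F p`. -/
def DiffeomorphicVia (S : Set Fields) (δ : Fields → C1 → Fields → Prop)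
    (G : TopologicalSpace.Opens Phase) (F : Fields → Phase) : Prop :=
  ∃ (_ : ChartedSpace (Plane × C0) S) (_ : IsManifold 𝓘(ℝ, Plane × C0) ∞ S)
    (_ : ChartedSpace Phase (PhaseSpace S δ)) (_ : IsManifold 𝓘(ℝ, Phase) ∞ (PhaseSpace S δ)),
    Manifold.IsSmoothEmbedding 𝓘(ℝ, Plane × C0) 𝓘(ℝ, Fields) ∞ (Subtype.val : S → Fields) ∧
    Manifold.IsSubmersion 𝓘(ℝ, Plane × C0) 𝓘(ℝ, Phase) ∞
      (Quot.mk (SymmetryArc S δ) : S → PhaseSpace S δ) ∧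
    ∃ Φ : Diffeomorph 𝓘(ℝ, Phase) 𝓘(ℝ, Phase) (PhaseSpace S δ) G ∞,
      ∀ p : S, (Φ (Quot.mk (SymmetryArc S δ) p) : Phase) = F p

/-- `(X, E) ↦ (X(0), ∫₀¹ E)`. -/
def mapE (p : Fields) : Phase :=
  (path p.1 0, ∫ u in (0 : ℝ)..1, Set.IccExtend zero_le_one p.2 u)

/-- `(X, η) ↦ (X(0), ∫₀¹ E)` with `E = H η`. -/
def mapEta (φ : Plane → ℝ) (p : Fields) : Phase :=
  (path p.1 0, ∫ u in (0 : ℝ)..1, expH φ p u • Set.IccExtend zero_le_one p.2 u)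

end PoissonSigma

end

open PoissonSigma

/-! The substitution `E = H η` straightens the Gauss law. Along a solution `φ(X(u)) = φ(X(0)) H(u)`,
so `φ(X) η = φ(X(0)) E` (`phi_path_of_gauss`, `phi_path_of_modified`, `toE_mem_iff`). The
exponential `H` of `(X, η)` equals the affine `H` of `(X, E)`, so `toE` is a diffeomorphism from the
fields with values in `U` onto those with positive affine `H` (`toEHomeo`). It turns the generator
`β` into `e = H β`. Everything thus reduces to the modified equations.

With `x = X(0)` these integrate explicitly: `X(u)` is `x_f` for the momentum `∫₀ᵘ E`. The solutions
form the zero set of the last coordinate of the global chart `(X(0), E, X' - φ(X(0)) J E)`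
(`sliceHomeo`), on which the map to `ℝ⁴` is the split linear surjection `(x, E) ↦ (x, ∫ E)`. By
`diffeomorphicVia_of_slice` it remains to show that this map is constant on classes, separates them
and has image `𝒢`.

Invariance: the variation of `E` is `e'`, with `e` zero at both ends. For the original symmetries
this rests on `primitive_fderiv_rateC`: the variation of `T` is a total derivative.

Separation (`eq_of_segments`): let two solutions share `x` and `∫ E`. If `φ(x) = 0`, both curves are
constant, `H` is affine in `E`, and the segment between the solutions works. If `φ(x) ≠ 0`, then `X`
determines `E`, and solutions starting at `x` are exactly the `C¹` curves in the leaf of `x`. Simple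
connectedness gives a homotopy, which is replaced by finitely many straight homotopies of `C¹`
curves; each is a segment of solutions whose velocity is a symmetry.

Image: it is the set of `(x, π)` in the positive set with `φ(x) = 0` or `x_f` in the leaf of `x`
(`image_mapE`). This set is open, as the image of an open map, and connected, by shortening the
integral to `∫₀ᵘ E`. The rest of the positive set lies in a disjoint open set, because leaves of
regular points are open and closed in the regular set. Hence it is a connected component
(`connectedComponentIn_positiveSet`). -/

noncomputable section

namespace PoissonSigma

open Topology Set

set_option linter.unusedSectionVars false

/-! ### Smoothness of superposition operators on spaces of continuous functions -/

section Nemytskii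

variable {K : Type} [TopologicalSpace K] [CompactSpace K]
  {V W Z : Type} [NormedAddCommGroup V] [NormedSpace ℝ V] [NormedAddCommGroup W] [NormedSpace ℝ W]
  [NormedAddCommGroup Z] [NormedSpace ℝ Z]

/-- The pointwise application of a bilinear map to continuous functions on a compact space. -/
def pointwise (B : V →L[ℝ] W →L[ℝ] Z) : C(K, V) →L[ℝ] C(K, W) →L[ℝ] C(K, Z) :=
  LinearMap.mkContinuous₂
    (LinearMap.mk₂ ℝ (fun f g => (⟨fun u => B (f u) (g u), by fun_prop⟩ : C(K, Z)))
      (fun f f' g => by ext u; simp) (fun c f g => by ext u; simp)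
      (fun f g g' => by ext u; simp) (fun c f g => by ext u; simp)) ‖B‖
    (fun f g => by
      refine (ContinuousMap.norm_le _ (by positivity)).2 fun u => ?_
      refine (B.le_opNorm₂ _ _).trans ?_
      gcongr
      · exact f.norm_coe_le_norm u
      · exact g.norm_coe_le_norm u)

@[simp]
lemma pointwise_apply (B : V →L[ℝ] W →L[ℝ] Z) (f : C(K, V)) (g : C(K, W)) (u : K) :
    pointwise B f g u = B (f u) (g u) := rfl

/-- The set of continuous functions with values in `D`. -/
def valuesIn (K : Type) [TopologicalSpace K] (D : Set V) : Set C(K, V) := {X | ∀ u, X u ∈ D}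

lemma isOpen_valuesIn {D : Set V} (hD : IsOpen D) : IsOpen (valuesIn K D) := by
  simpa [valuesIn, MapsTo] using
    ContinuousMap.isOpen_setOfPred_mapsTo (X := K) isCompact_univ hD

open Classical in
/-- The Nemytskii (superposition) operator `X ↦ ψ ∘ X`, with value `0` where `ψ ∘ X` is not
continuous. -/
def nemytskii (ψ : V → W) (X : C(K, V)) : C(K, W) :=
  if h : Continuous (ψ ∘ X) then ⟨ψ ∘ X, h⟩ else 0

lemma nemytskii_apply {D : Set V} {ψ : V → W} (hψ : ContinuousOn ψ D) {X : C(K, V)}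
    (hX : X ∈ valuesIn K D) (u : K) : nemytskii ψ X u = ψ (X u) := by
  have h : Continuous (ψ ∘ X) := hψ.comp_continuous X.continuous hX
  simp [nemytskii, h]

/-- The range of `X` is compact, so one radius serves all its points: there `fderiv ℝ ψ` varies by
less than `c`, and the mean value inequality on balls gives the remainder bound uniformly in `u`. -/
lemma hasFDerivAt_nemytskii {D : Set V} (hD : IsOpen D) {ψ : V → W} (hψ : ContDiffOn ℝ 1 ψ D)
    {X : C(K, V)} (hX : X ∈ valuesIn K D) :
    HasFDerivAt (nemytskii ψ)
      (pointwise (ContinuousLinearMap.id ℝ (V →L[ℝ] W)) (nemytskii (fderiv ℝ ψ) X)) X := by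
  have hcont : ContinuousOn (fderiv ℝ ψ) D := hψ.continuousOn_fderiv_of_isOpen hD le_rfl
  have hK : IsCompact (range X) := isCompact_range X.continuous
  have hKD : range X ⊆ D := by rintro _ ⟨u, rfl⟩; exact hX u
  obtain ⟨r, hr, hrD⟩ := hK.exists_thickening_subset_open hD hKD
  refine HasFDerivAt.of_isLittleO ?_
  rw [Asymptotics.isLittleO_iff]
  intro c hc
  have huc := hK.uniformContinuousAt_of_continuousAt (fderiv ℝ ψ)
    (fun y hy => (hcont.continuousAt (hD.mem_nhds (hKD hy)))) (Metric.dist_mem_uniformity hc)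
  obtain ⟨d, hd, hd'⟩ := Metric.mem_uniformity_dist.1 huc
  filter_upwards [Metric.ball_mem_nhds X (lt_min hr hd)] with Y hY
  have hYX : ∀ u, dist (Y u) (X u) < min r d := fun u =>
    (ContinuousMap.dist_apply_le_dist u).trans_lt hY
  have hseg : ∀ u, ∀ z ∈ Metric.ball (X u) (min r d), z ∈ D := fun u z hz =>
    hrD (Metric.mem_thickening_iff.2 ⟨X u, ⟨u, rfl⟩, (lt_min_iff.1 (Metric.mem_ball.1 hz)).1⟩)
  have hYD : Y ∈ valuesIn K D := fun u => hseg u _ (hYX u)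
  refine (ContinuousMap.norm_le _ (by positivity)).2 fun u => ?_
  simp only [ContinuousMap.sub_apply, pointwise_apply, ContinuousLinearMap.coe_id', id_eq]
  rw [nemytskii_apply hψ.continuousOn hYD, nemytskii_apply hψ.continuousOn hX,
    nemytskii_apply hcont hX]
  have := (convex_ball (X u) (min r d)).norm_image_sub_le_of_norm_hasFDerivWithin_le' (𝕜 := ℝ)
    (f := ψ) (f' := fderiv ℝ ψ) (φ := fderiv ℝ ψ (X u)) (C := c) (x := X u) (y := Y u)
    (fun z hz => (((hψ.differentiableOn one_ne_zero).differentiableAt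
      (hD.mem_nhds (hseg u z hz))).hasFDerivAt).hasFDerivWithinAt)
    (fun z hz => ?_) (Metric.mem_ball_self (lt_min hr hd)) (hYX u)
  · refine this.trans ?_
    gcongr
    exact (Y - X).norm_coe_le_norm u
  · rw [← dist_eq_norm, dist_comm]
    refine (hd' (a := X u) (b := z) ?_ ⟨u, rfl⟩).le
    rw [dist_comm]
    exact (lt_min_iff.1 (Metric.mem_ball.1 hz)).2

/-- The derivative is a continuous linear map applied to the superposition operator of `fderiv ℝ ψ`,
so one induction on the order suffices, provided the codomain `W` is allowed to change. -/
lemma contDiffOn_nemytskii_nat {D : Set V} (hD : IsOpen D) (n : ℕ) :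
    ∀ {W : Type} [NormedAddCommGroup W] [NormedSpace ℝ W] {ψ : V → W}, ContDiffOn ℝ ∞ ψ D →
      ContDiffOn ℝ n (nemytskii (K := K) ψ) (valuesIn K D) := by
  induction n with
  | zero =>
    intro W _ _ ψ hψ
    rw [Nat.cast_zero, contDiffOn_zero]
    exact fun X hX => (hasFDerivAt_nemytskii hD (hψ.of_le (by norm_cast))
      hX).continuousAt.continuousWithinAt
  | succ n ih =>
    intro W _ _ ψ hψ
    rw [Nat.cast_succ, contDiffOn_succ_iff_fderiv_of_isOpen (isOpen_valuesIn hD)]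
    have h1 : ContDiffOn ℝ 1 ψ D := hψ.of_le (by norm_cast)
    refine ⟨fun X hX => (hasFDerivAt_nemytskii hD h1
      hX).differentiableAt.differentiableWithinAt, by simp, ?_⟩
    have h2 : ContDiffOn ℝ ∞ (fderiv ℝ ψ) D := hψ.fderiv_of_isOpen hD (by simp)
    exact ((ContinuousLinearMap.contDiff _).comp_contDiffOn (ih h2)).congr
      fun X hX => (hasFDerivAt_nemytskii hD h1 hX).fderiv

lemma contDiffOn_nemytskii {D : Set V} (hD : IsOpen D) {ψ : V → W} (hψ : ContDiffOn ℝ ∞ ψ D) :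
    ContDiffOn ℝ ∞ (nemytskii (K := K) ψ) (valuesIn K D) :=
  contDiffOn_infty.2 fun n => contDiffOn_nemytskii_nat hD n hψ

end Nemytskii

/-! ### Calculus on the unit interval: primitives and derivatives -/

section Primitive

variable {V : Type} [NormedAddCommGroup V] [NormedSpace ℝ V] [CompleteSpace V]

lemma continuous_iccExtend (f : C(unitInterval, V)) :
    Continuous (IccExtend (zero_le_one' ℝ) f) := f.continuous.Icc_extend'

lemma continuous_iccIntegral (f : C(unitInterval, V)) :
    Continuous fun u : ℝ => ∫ v in (0 : ℝ)..u, IccExtend (zero_le_one' ℝ) f v :=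
  continuous_iff_continuousAt.2 fun u => ((continuous_iccExtend f).integral_hasStrictDerivAt
    0 u).hasDerivAt.continuousAt

/-- The primitive `u ↦ ∫₀ᵘ f` of a continuous function on `[0, 1]`. -/
def primitive (V : Type) [NormedAddCommGroup V] [NormedSpace ℝ V] [CompleteSpace V] :
    C(unitInterval, V) →L[ℝ] C(unitInterval, V) :=
  LinearMap.mkContinuous
    { toFun := fun f => ⟨fun u => ∫ v in (0 : ℝ)..u, IccExtend (zero_le_one' ℝ) f v,
        (continuous_iccIntegral f).comp continuous_subtype_val⟩
      map_add' := fun f g => by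
        ext u
        exact intervalIntegral.integral_add ((continuous_iccExtend f).intervalIntegrable _ _)
          ((continuous_iccExtend g).intervalIntegrable _ _)
      map_smul' := fun c f => by
        ext u
        exact intervalIntegral.integral_smul c _ } 1
    (fun f => by
      refine (ContinuousMap.norm_le _ (by positivity)).2 fun u => ?_
      refine (intervalIntegral.norm_integral_le_of_norm_le_const (C := ‖f‖) fun v _ =>
        f.norm_coe_le_norm _).trans ?_
      rw [sub_zero, abs_of_nonneg u.2.1, one_mul]
      exact mul_le_of_le_one_right (norm_nonneg _) u.2.2)

lemma primitive_apply (f : C(unitInterval, V)) (u : unitInterval) :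
    primitive V f u = ∫ v in (0 : ℝ)..u, IccExtend (zero_le_one' ℝ) f v := rfl

@[simp]
lemma primitive_zero_right (f : C(unitInterval, V)) : primitive V f 0 = 0 := by
  simp [primitive_apply]

/-- `g` is the derivative of `f` on the unit interval. -/
def DerivOn (f g : C(unitInterval, V)) : Prop :=
  ∀ u : unitInterval, HasDerivWithinAt (IccExtend (zero_le_one' ℝ) f) (g u) (Icc 0 1) (u : ℝ)

lemma derivOn_primitive (f : C(unitInterval, V)) : DerivOn (primitive V f) f := by
  intro u
  have h : HasDerivAt (fun u : ℝ => ∫ v in (0 : ℝ)..u, IccExtend (zero_le_one' ℝ) f v)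
      (IccExtend (zero_le_one' ℝ) f u) u :=
    ((continuous_iccExtend f).integral_hasStrictDerivAt 0 u).hasDerivAt
  rw [IccExtend_val] at h
  refine h.hasDerivWithinAt.congr (fun v hv => ?_) ?_
  · rw [IccExtend_of_mem _ _ hv, primitive_apply]
  · rw [IccExtend_val, primitive_apply]

lemma derivOn_const (c : V) : DerivOn (ContinuousMap.const unitInterval c) 0 :=
  fun u => hasDerivWithinAt_const (u : ℝ) (Icc 0 1) c

lemma DerivOn.add {f g f' g' : C(unitInterval, V)} (hf : DerivOn f f') (hg : DerivOn g g') :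
    DerivOn (f + g) (f' + g') := fun u => (hf u).add (hg u)

lemma DerivOn.sub {f g f' g' : C(unitInterval, V)} (hf : DerivOn f f') (hg : DerivOn g g') :
    DerivOn (f - g) (f' - g') := fun u => (hf u).sub (hg u)

lemma DerivOn.eq_const {f : C(unitInterval, V)} (hf : DerivOn f 0) (u : unitInterval) :
    f u = f 0 := by
  have := (convex_Icc (0 : ℝ) 1).norm_image_sub_le_of_norm_hasDerivWithin_le (C := 0)
    (f := IccExtend (zero_le_one' ℝ) f) (f' := fun _ => (0 : V))
    (fun x hx => hf ⟨x, hx⟩) (by simp) (x := 0) (y := u) ⟨le_rfl, zero_le_one⟩ u.2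
  rw [zero_mul, norm_le_zero_iff, sub_eq_zero, IccExtend_val] at this
  rw [this]
  exact IccExtend_val (zero_le_one' ℝ) f 0

/-- The fundamental theorem of calculus on `[0, 1]`. -/
lemma DerivOn.eq_primitive {f f' : C(unitInterval, V)} (hf : DerivOn f f') (u : unitInterval) :
    f u = f 0 + primitive V f' u := by
  have h := hf.sub (derivOn_primitive f')
  rw [sub_self] at h
  have := h.eq_const u
  simp only [ContinuousMap.sub_apply, primitive_zero_right, sub_zero] at this
  rw [← this, sub_add_cancel]

lemma DerivOn.unique {f f' g' : C(unitInterval, V)} (h : DerivOn f f') (h' : DerivOn f g') :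
    f' = g' := by
  ext u
  exact (uniqueDiffOn_Icc (zero_lt_one' ℝ) u u.2).eq_deriv _ (h u) (h' u)

lemma DerivOn.clm {W : Type} [NormedAddCommGroup W] [NormedSpace ℝ W] [CompleteSpace W]
    {f f' : C(unitInterval, V)} (h : DerivOn f f') (L : V →L[ℝ] W) :
    DerivOn (L.compLeftContinuous ℝ unitInterval f) (L.compLeftContinuous ℝ unitInterval f') :=
  fun u => L.hasFDerivAt.comp_hasDerivWithinAt (u : ℝ) (h u)

lemma DerivOn.comp {W : Type} [NormedAddCommGroup W] [NormedSpace ℝ W] [CompleteSpace W]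
    {f f' : C(unitInterval, V)} (h : DerivOn f f') {D : Set V} (hD : IsOpen D) {ψ : V → W}
    (hψ : ContDiffOn ℝ ∞ ψ D) (hf : f ∈ valuesIn unitInterval D) :
    DerivOn (nemytskii ψ f)
      (pointwise (ContinuousLinearMap.id ℝ (V →L[ℝ] W)) (nemytskii (fderiv ℝ ψ) f) f') := by
  intro u
  have h1 : HasFDerivAt ψ (fderiv ℝ ψ (f u)) (IccExtend (zero_le_one' ℝ) f u) := by
    rw [IccExtend_val]
    exact ((hψ.differentiableOn (by simp)).differentiableAt (hD.mem_nhds (hf u))).hasFDerivAt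
  have h2 := h1.comp_hasDerivWithinAt (u : ℝ) (h u)
  have hc : ContinuousOn (fderiv ℝ ψ) D := hψ.continuousOn_fderiv_of_isOpen hD (by simp)
  simp only [pointwise_apply, ContinuousLinearMap.coe_id', id_eq, nemytskii_apply hc hf]
  refine h2.congr (fun v hv => ?_) ?_
  · rw [IccExtend_of_mem _ _ hv, nemytskii_apply hψ.continuousOn hf, Function.comp,
      IccExtend_of_mem _ _ hv]
  · rw [IccExtend_val, nemytskii_apply hψ.continuousOn hf, Function.comp, IccExtend_val]

lemma DerivOn.bilin {W Z : Type} [NormedAddCommGroup W] [NormedSpace ℝ W] [CompleteSpace W]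
    [NormedAddCommGroup Z] [NormedSpace ℝ Z] [CompleteSpace Z] (B : V →L[ℝ] W →L[ℝ] Z)
    {f f' : C(unitInterval, V)} {g g' : C(unitInterval, W)} (hf : DerivOn f f')
    (hg : DerivOn g g') :
    DerivOn (pointwise B f g) (pointwise B f g' + pointwise B f' g) := by
  intro u
  have := B.hasDerivWithinAt_of_bilinear (hf u) (hg u)
  simp only [IccExtend_val] at this
  exact this

/-- Evaluation at a point of `[0, 1]`. -/
def evalL (V : Type) [NormedAddCommGroup V] [NormedSpace ℝ V] (u : unitInterval) :
    C(unitInterval, V) →L[ℝ] V := ContinuousMap.evalCLM ℝ u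

@[simp]
lemma evalL_apply (u : unitInterval) (f : C(unitInterval, V)) : evalL V u f = f u := rfl

/-- Constant functions. -/
def constL (V : Type) [NormedAddCommGroup V] [NormedSpace ℝ V] :
    V →L[ℝ] C(unitInterval, V) :=
  LinearMap.mkContinuous
    { toFun := ContinuousMap.const unitInterval
      map_add' := fun _ _ => rfl
      map_smul' := fun _ _ => rfl } 1 fun x => by
      refine (ContinuousMap.norm_le _ (by positivity)).2 fun u => ?_
      rw [one_mul]
      exact le_rfl

@[simp]
lemma constL_apply (x : V) (u : unitInterval) : constL V x u = x := rfl

@[simp]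
lemma primitive_constL (x : V) (u : unitInterval) : primitive V (constL V x) u = (u : ℝ) • x := by
  rw [primitive_apply]
  have : IccExtend (zero_le_one' ℝ) (constL V x) = fun _ => x := rfl
  simp [this]

end Primitive

/-! ### Coordinates on the space of `C¹` curves and on the space of fields -/

section C1

lemma derivOn_path (X : C1) : DerivOn (path X) (dpath X) := X.2

/-- `path` as a continuous linear map. -/
def pathL : C1 →L[ℝ] C0 := (ContinuousLinearMap.fst ℝ C0 C0).comp C1.subtypeL

/-- `dpath` as a continuous linear map. -/
def dpathL : C1 →L[ℝ] C0 := (ContinuousLinearMap.snd ℝ C0 C0).comp C1.subtypeL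

@[simp] lemma pathL_apply (X : C1) : pathL X = path X := rfl

@[simp] lemma dpathL_apply (X : C1) : dpathL X = dpath X := rfl

lemma C1.ext' {X Y : C1} (h0 : path X 0 = path Y 0) (hd : dpath X = dpath Y) : X = Y := by
  refine Subtype.ext (Prod.ext (ContinuousMap.ext fun u => ?_) hd)
  have hX := (derivOn_path X).eq_primitive u
  have hY := (derivOn_path Y).eq_primitive u
  rw [h0, hd, ← hY] at hX
  exact hX

/-- The curve in `C¹` with given starting point and derivative. -/
def mkC1 : (Plane × C0) →L[ℝ] C1 :=
  (ContinuousLinearMap.prod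
    ((constL Plane).comp (ContinuousLinearMap.fst ℝ Plane C0) +
      (primitive Plane).comp (ContinuousLinearMap.snd ℝ Plane C0))
    (ContinuousLinearMap.snd ℝ Plane C0)).codRestrict C1 fun p => by
      have := (derivOn_const p.1).add (derivOn_primitive p.2)
      rw [zero_add] at this
      exact this

@[simp] lemma path_mkC1 (p : Plane × C0) (u : unitInterval) :
    path (mkC1 p) u = p.1 + primitive Plane p.2 u := rfl

@[simp] lemma dpath_mkC1 (p : Plane × C0) : dpath (mkC1 p) = p.2 := rfl

lemma mkC1_eq (X : C1) : mkC1 (path X 0, dpath X) = X := C1.ext' (by simp) (by simp)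

/-- `C¹ × C⁰` is identified with `ℝ² × C⁰ × C⁰`. -/
def fieldsEquiv : ((Plane × C0) × C0) ≃L[ℝ] Fields :=
  ContinuousLinearEquiv.equivOfInverse
    ((mkC1.comp (((ContinuousLinearMap.fst ℝ Plane C0).comp
      (ContinuousLinearMap.fst ℝ (Plane × C0) C0)).prod
        (ContinuousLinearMap.snd ℝ (Plane × C0) C0))).prod
      ((ContinuousLinearMap.snd ℝ Plane C0).comp (ContinuousLinearMap.fst ℝ (Plane × C0) C0)))
    (((((evalL Plane 0).comp pathL).comp (ContinuousLinearMap.fst ℝ C1 C0)).prod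
      (ContinuousLinearMap.snd ℝ C1 C0)).prod (dpathL.comp (ContinuousLinearMap.fst ℝ C1 C0)))
    (fun p => by simp)
    (fun p => by simp [mkC1_eq])

/-- The total integral on `C⁰`. -/
def integralL : C0 →L[ℝ] Plane := (evalL Plane 1).comp (primitive Plane)

/-- The splitting of `ℝ² × C⁰` given by the submersion `(x, E) ↦ (x, ∫ E)`. -/
def phaseEquiv : (Plane × C0) ≃L[ℝ] (Phase × (integralL.ker)) :=
  ContinuousLinearEquiv.equivOfInverse
    (((ContinuousLinearMap.fst ℝ Plane C0).prod
      (integralL.comp (ContinuousLinearMap.snd ℝ Plane C0))).prod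
      -- Constants complement the kernel of the integral: over `[0,1]` a constant is its own
      -- integral.
      (((ContinuousLinearMap.snd ℝ Plane C0) -
        (constL Plane).comp (integralL.comp (ContinuousLinearMap.snd ℝ Plane C0))).codRestrict
        (integralL.ker) fun p => by
          simp [integralL]))
    (((ContinuousLinearMap.fst ℝ Plane Plane).comp (ContinuousLinearMap.fst ℝ Phase _)).prod
      ((constL Plane).comp ((ContinuousLinearMap.snd ℝ Plane Plane).comp
        (ContinuousLinearMap.fst ℝ Phase _)) +
        (integralL.ker).subtypeL.comp (ContinuousLinearMap.snd ℝ Phase _)))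
    (fun p => by
      refine Prod.ext (by simp) ?_
      change constL Plane (integralL p.2) + (p.2 - constL Plane (integralL p.2)) = p.2
      abel)
    (fun p => by
      have h : integralL (p.2 : C0) = 0 := p.2.2
      have h' : integralL (constL Plane p.1.2) = p.1.2 := by simp [integralL]
      refine Prod.ext (Prod.ext ?_ ?_) (Subtype.ext ?_)
      · simp
      · simp [h, h']
      · change (constL Plane p.1.2 + (p.2 : C0)) - constL Plane (integralL
          (constL Plane p.1.2 + (p.2 : C0))) = p.2
        rw [map_add, h, h', add_zero, add_sub_cancel_left])

@[simp] lemma phaseEquiv_fst (p : Plane × C0) : (phaseEquiv p).1 = (p.1, integralL p.2) := rfl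

end C1

/-! ### Quotients of slices -/

section Slice

variable {S : Set Fields} (Ψ : OpenPartialHomeomorph Fields ((Plane × C0) × C0))

/-- The global chart of `S = {Ψ₂ = 0}`. -/
def sliceChart (hS : ∀ p, p ∈ S ↔ p ∈ Ψ.source ∧ (Ψ p).2 = 0) (hne : S.Nonempty) :
    OpenPartialHomeomorph S (Plane × C0) where
  toFun p := (Ψ p).1
  invFun y := open Classical in
    if h : Ψ.symm (y, 0) ∈ S then ⟨Ψ.symm (y, 0), h⟩ else ⟨hne.some, hne.some_mem⟩
  source := univ
  target := {y | (y, 0) ∈ Ψ.target}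
  map_source' p _ := by
    have hp := (hS p).1 p.2
    change ((Ψ p).1, (0 : C0)) ∈ Ψ.target
    rw [← hp.2]
    exact Ψ.map_source hp.1
  map_target' _ _ := mem_univ _
  left_inv' p _ := by
    have hp := (hS p).1 p.2
    have h1 : Ψ.symm ((Ψ p).1, 0) = p := by
      rw [← hp.2]
      exact Ψ.left_inv hp.1
    simp [h1]
  right_inv' y hy := by
    have h1 : Ψ.symm (y, 0) ∈ S := (hS _).2 ⟨Ψ.map_target hy, by rw [Ψ.right_inv hy]⟩
    simp [h1, Ψ.right_inv hy]
  open_source := isOpen_univ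
  open_target := Ψ.open_target.preimage (by fun_prop)
  continuousOn_toFun := by
    have h : MapsTo (Subtype.val : S → Fields) univ Ψ.source := fun p _ => ((hS p).1 p.2).1
    exact continuous_fst.comp_continuousOn
      (Ψ.continuousOn.comp continuous_subtype_val.continuousOn h)
  continuousOn_invFun := by
    rw [IsInducing.subtypeVal.continuousOn_iff]
    refine (Ψ.continuousOn_symm.comp (f := fun y : Plane × C0 => (y, (0 : C0)))
      (by fun_prop) (fun y hy => hy)).congr fun y hy => ?_
    have h1 : Ψ.symm (y, 0) ∈ S := (hS _).2 ⟨Ψ.map_target hy, by rw [Ψ.right_inv hy]⟩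
    simp [h1]

variable {Ψ}

lemma sliceChart_symm_apply (hS : ∀ p, p ∈ S ↔ p ∈ Ψ.source ∧ (Ψ p).2 = 0) (hne : S.Nonempty)
    {y : Plane × C0} (hy : (y, 0) ∈ Ψ.target) :
    ((sliceChart Ψ hS hne).symm y : Fields) = Ψ.symm (y, 0) := by
  have h1 : Ψ.symm (y, 0) ∈ S := (hS _).2 ⟨Ψ.map_target hy, by rw [Ψ.right_inv hy]⟩
  exact congrArg Subtype.val (dif_pos h1)

variable {δ : Fields → C1 → Fields → Prop} {F : Fields → Phase}
  (hinv : ∀ p q : S, SymmetryArc S δ p q → F p = F q)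

/-- The map induced on the quotient by an invariant map. -/
def quotMap : PhaseSpace S δ → Phase :=
  Quot.lift (fun p : S => F p) hinv

lemma isOpenMap_phase : IsOpenMap fun y : Plane × C0 => ((y.1, integralL y.2) : Phase) :=
  (isOpenMap_fst (X := Phase)).comp phaseEquiv.toHomeomorph.isOpenMap

/-- Injectivity is the separation hypothesis. For openness, the image of `V` equals the image under
`F` of its preimage in `S`, and in the slice chart `F` is the open map `(x, E) ↦ (x, ∫ E)`. This
single embedding then serves as an atlas of the quotient. -/
lemma isOpenEmbedding_quotMap (hS : ∀ p, p ∈ S ↔ p ∈ Ψ.source ∧ (Ψ p).2 = 0) (hne : S.Nonempty)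
    (hF : ∀ p ∈ S, F p = ((Ψ p).1.1, integralL (Ψ p).1.2))
    (hsep : ∀ p q : S, F p = F q →
      (Quot.mk (SymmetryArc S δ) p : PhaseSpace S δ) = Quot.mk (SymmetryArc S δ) q) :
    IsOpenEmbedding (quotMap hinv) := by
  set c := sliceChart Ψ hS hne
  have hFc : (fun p : S => F p) = (fun y : Plane × C0 => ((y.1, integralL y.2) : Phase)) ∘ c :=
    funext fun p => hF p p.2
  have hc : Continuous c := continuousOn_univ.1 c.continuousOn
  have hco : IsOpenMap c := by
    intro V hV
    exact c.isOpen_image_of_subset_source hV (subset_univ _)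
  refine .of_continuous_injective_isOpenMap ?_ ?_ ?_
  · refine continuous_quot_lift hinv ?_
    rw [hFc]
    exact Continuous.comp (by fun_prop) hc
  · rintro ⟨p⟩ ⟨q⟩ h
    exact hsep p q h
  · intro V hV
    have : quotMap hinv '' V = (fun p : S => F p) '' (Quot.mk (SymmetryArc S δ) ⁻¹' V) := by
      ext y
      constructor
      · rintro ⟨⟨p⟩, hp, rfl⟩
        exact ⟨p, hp, rfl⟩
      · rintro ⟨p, hp, rfl⟩
        exact ⟨_, hp, rfl⟩
    rw [this, hFc]
    exact (isOpenMap_phase.comp hco) _ (hV.preimage continuous_quot_mk)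

end Slice

/-- A set of fields that is a smooth slice, with an invariant submersion that separates the
classes, has a smooth quotient. -/
theorem diffeomorphicVia_of_slice {S : Set Fields} {δ : Fields → C1 → Fields → Prop}
    {G : TopologicalSpace.Opens Phase} {F : Fields → Phase}
    (Ψ : OpenPartialHomeomorph Fields ((Plane × C0) × C0))
    (hΨ : ContDiffOn ℝ ∞ Ψ Ψ.source) (hΨ' : ContDiffOn ℝ ∞ Ψ.symm Ψ.target)
    (hS : ∀ p, p ∈ S ↔ p ∈ Ψ.source ∧ (Ψ p).2 = 0) (hne : S.Nonempty)
    (hF : ∀ p ∈ S, F p = ((Ψ p).1.1, integralL (Ψ p).1.2))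
    (hG : F '' S = G)
    (hinv : ∀ p q : S, SymmetryArc S δ p q → F p = F q)
    (hsep : ∀ p q : S, F p = F q →
      (Quot.mk (SymmetryArc S δ) p : PhaseSpace S δ) = Quot.mk (SymmetryArc S δ) q) :
    DiffeomorphicVia S δ G F := by
  have hne' : Nonempty S := hne.to_subtype
  have hneQ : Nonempty (PhaseSpace S δ) := ⟨Quot.mk _ hne'.some⟩
  set c := sliceChart Ψ hS hne with hc
  have hcs : c.source = univ := rfl
  have hemb := isOpenEmbedding_quotMap hinv hS hne hF hsep
  let i1 : ChartedSpace (Plane × C0) S := c.singletonChartedSpace hcs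
  have i2 : IsManifold 𝓘(ℝ, Plane × C0) ∞ S := c.isManifold_singleton hcs
  let i3 : ChartedSpace Phase (PhaseSpace S δ) := hemb.singletonChartedSpace
  have i4 : IsManifold 𝓘(ℝ, Phase) ∞ (PhaseSpace S δ) := hemb.isManifold_singleton
  have hc1 : c ∈ IsManifold.maximalAtlas 𝓘(ℝ, Plane × C0) ∞ S :=
    IsManifold.subset_maximalAtlas (mem_singleton _)
  refine ⟨i1, i2, i3, i4, ⟨⟨C0, inferInstance, inferInstance, fun p => ?_⟩,
    IsEmbedding.subtypeVal⟩, ⟨integralL.ker, inferInstance, inferInstance, fun p => ?_⟩, ?_⟩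
  · refine .mk_of_continuousAt continuous_subtype_val.continuousAt fieldsEquiv c
      (Ψ.trans fieldsEquiv.toHomeomorph.toOpenPartialHomeomorph) (mem_univ _) ?_ hc1 ?_ ?_
    · simpa using ((hS p).1 p.2).1
    · refine OpenPartialHomeomorph.mem_maximalAtlas_of_contMDiffOn (I := 𝓘(ℝ, Fields)) _ ?_ ?_
      · rw [contMDiffOn_iff_contDiffOn]
        have h1 : ContDiff ℝ ∞ fieldsEquiv := by fun_prop
        refine (h1.comp_contDiffOn hΨ).mono ?_
        simp
      · rw [contMDiffOn_iff_contDiffOn]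
        have h1 : ContDiff ℝ ∞ fieldsEquiv.symm := by fun_prop
        exact hΨ'.comp h1.contDiffOn fun y hy => by simpa using hy
    · intro y hy
      have hy0 : y ∈ c.target := by simpa using hy
      have hy' : (y, (0 : C0)) ∈ Ψ.target := hy0
      have h2 : ((c.symm y : S) : Fields) = Ψ.symm (y, 0) := sliceChart_symm_apply hS hne hy'
      simp [h2, Ψ.right_inv hy']
  -- In the global charts the projection is the first component of `phaseEquiv`, with complement the
  -- kernel of the integral.
  · refine .mk_of_continuousAt continuous_quot_mk.continuousAt phaseEquiv c
      (hemb.toOpenPartialHomeomorph _) (mem_univ _) (mem_univ _) hc1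
      (IsManifold.subset_maximalAtlas (mem_singleton _)) ?_
    intro y hy
    have hy' : y ∈ c.target := by simpa using hy
    have h3 : (Ψ (c.symm y : S)).1 = y := c.right_inv hy'
    have h4 := hF _ (c.symm y).2
    rw [h3] at h4
    simpa [quotMap] using h4
  · have hrange : range (quotMap hinv) = G := by
      rw [← hG]
      ext y
      constructor
      · rintro ⟨⟨p⟩, rfl⟩
        exact ⟨p, p.2, rfl⟩
      · rintro ⟨p, hp, rfl⟩
        exact ⟨Quot.mk _ ⟨p, hp⟩, rfl⟩
    have hmem : ∀ q, quotMap hinv q ∈ G := fun q => by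
      rw [← SetLike.mem_coe, ← hrange]
      exact mem_range_self q
    have hinvF : ∀ y ∈ G, quotMap hinv ((hemb.toOpenPartialHomeomorph _).symm y) = y :=
      fun y hy => by
        rw [← SetLike.mem_coe, ← hrange] at hy
        exact (hemb.toOpenPartialHomeomorph _).right_inv (by simpa using hy)
    refine ⟨⟨⟨fun q => ⟨quotMap hinv q, hmem q⟩,
      (hemb.toOpenPartialHomeomorph _).symm ∘ Subtype.val, fun q => ?_, fun y => ?_⟩,
      ?_, ?_⟩, fun p => rfl⟩
    · exact (hemb.toOpenPartialHomeomorph _).left_inv (mem_univ q)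
    · exact Subtype.ext (hinvF y y.2)
    · rw [← ContMDiff.subtypeVal_comp_iff]
      exact contMDiff_isOpenEmbedding hemb
    · have h1 : ContMDiff 𝓘(ℝ, Phase) 𝓘(ℝ, Phase) ∞ (Subtype.val : G → Phase) :=
        contMDiff_subtype_val
      have h2 := contMDiffOn_isOpenEmbedding_symm (I := 𝓘(ℝ, Phase)) (n := ∞) hemb
      refine h2.comp_contMDiff h1 fun y => ?_
      rw [hrange]
      exact y.2

lemma contDiff_pathL : ContDiff ℝ ∞ pathL := by fun_prop

lemma contDiff_dpathL : ContDiff ℝ ∞ dpathL := by fun_prop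

lemma contDiff_mkC1 : ContDiff ℝ ∞ mkC1 := by fun_prop

/-! ### Scalar linear equations, exponentials and inverses of functions -/

section ScalarODE

/-- Multiplication of a continuous function by a continuous scalar function. -/
def scale (V : Type) [NormedAddCommGroup V] [NormedSpace ℝ V] :
    C(unitInterval, ℝ) →L[ℝ] C(unitInterval, V) →L[ℝ] C(unitInterval, V) :=
  pointwise (ContinuousLinearMap.lsmul ℝ ℝ)

@[simp]
lemma scale_apply {V : Type} [NormedAddCommGroup V] [NormedSpace ℝ V] (a : C(unitInterval, ℝ))
    (f : C(unitInterval, V)) (u : unitInterval) : scale V a f u = a u • f u := rfl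

lemma mem_valuesIn_univ {V : Type} [NormedAddCommGroup V] (f : C(unitInterval, V)) :
    f ∈ valuesIn unitInterval (univ : Set V) := fun _ => mem_univ _

/-- The exponential of a continuous function. -/
def expC (T : C(unitInterval, ℝ)) : C(unitInterval, ℝ) := nemytskii Real.exp T

@[simp]
lemma expC_apply (T : C(unitInterval, ℝ)) (u : unitInterval) : expC T u = Real.exp (T u) :=
  nemytskii_apply Real.continuous_exp.continuousOn (mem_valuesIn_univ T) u

lemma contDiff_expC : ContDiff ℝ ∞ expC := by
  rw [← contDiffOn_univ]
  exact (contDiffOn_nemytskii isOpen_univ Real.contDiff_exp.contDiffOn).mono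
    fun f _ => mem_valuesIn_univ f

lemma DerivOn.exp_comp {f f' : C(unitInterval, ℝ)} (h : DerivOn f f') :
    DerivOn (expC f) (scale ℝ (expC f) f') := by
  have := h.comp isOpen_univ Real.contDiff_exp.contDiffOn (mem_valuesIn_univ f)
  have e : scale ℝ (expC f) f' = pointwise (ContinuousLinearMap.id ℝ (ℝ →L[ℝ] ℝ))
      (nemytskii (fderiv ℝ Real.exp) f) f' := by
    ext u
    rw [pointwise_apply, nemytskii_apply (Real.contDiff_exp.contDiffOn.continuousOn_fderiv_of_isOpen
      isOpen_univ le_rfl) (mem_valuesIn_univ f)]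
    simp [mul_comm]
  rw [e]
  exact this

/-- The solution of the scalar linear equation `g' = T g`. -/
lemma DerivOn.eq_mul_exp {g T : C(unitInterval, ℝ)} (h : DerivOn g (scale ℝ T g))
    (u : unitInterval) : g u = g 0 * Real.exp (primitive ℝ T u) := by
  have h1 : DerivOn (-primitive ℝ T) (-T) := fun u => (derivOn_primitive T u).neg
  have h2 := h1.exp_comp.bilin (ContinuousLinearMap.lsmul ℝ ℝ) h
  -- Integrating factor: `g exp(-∫T)` has zero derivative.
  have h3 : DerivOn (scale ℝ (expC (-primitive ℝ T)) g) 0 := by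
    have e : pointwise (ContinuousLinearMap.lsmul ℝ ℝ) (expC (-primitive ℝ T))
        (scale ℝ T g) + pointwise (ContinuousLinearMap.lsmul ℝ ℝ)
          (scale ℝ (expC (-primitive ℝ T)) (-T)) g = 0 := by
      ext u
      simp
      ring
    rw [e] at h2
    exact h2
  have h4 := h3.eq_const u
  simp only [scale_apply, expC_apply, ContinuousMap.neg_apply, primitive_zero_right, neg_zero,
    Real.exp_zero, smul_eq_mul, one_mul] at h4
  rw [← h4, mul_right_comm, ← Real.exp_add]
  simp

/-- The pointwise inverse of a positive continuous function. -/
def invC (f : C(unitInterval, ℝ)) : C(unitInterval, ℝ) := nemytskii (fun x : ℝ => x⁻¹) f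

lemma contDiffOn_inv_Ioi : ContDiffOn ℝ ∞ (fun x : ℝ => x⁻¹) (Ioi 0) :=
  contDiffOn_id.inv fun _ hx => (mem_Ioi.1 hx).ne'

lemma invC_apply {f : C(unitInterval, ℝ)} (hf : f ∈ valuesIn unitInterval (Ioi (0 : ℝ)))
    (u : unitInterval) : invC f u = (f u)⁻¹ :=
  nemytskii_apply contDiffOn_inv_Ioi.continuousOn hf u

lemma contDiffOn_invC : ContDiffOn ℝ ∞ invC (valuesIn unitInterval (Ioi 0)) :=
  contDiffOn_nemytskii isOpen_Ioi contDiffOn_inv_Ioi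

lemma DerivOn.eq_exp_primitive {f f' T : C(unitInterval, ℝ)} (h : DerivOn f f')
    (hT : ∀ u, f' u = T u * f u) (h0 : f 0 = 1) (u : unitInterval) :
    f u = Real.exp (primitive ℝ T u) := by
  have h1 : f' = scale ℝ T f := ContinuousMap.ext fun u => by simp [hT]
  rw [h1] at h
  rw [h.eq_mul_exp, h0, one_mul]

end ScalarODE

/-! ### The function `H` and the passage between the Gauss law and the modified equations -/

section Rates

/-- The linear map `a ↦ (-a₂, a₁)`. -/
def rot : Plane →L[ℝ] Plane :=
  (-(ContinuousLinearMap.snd ℝ ℝ ℝ)).prod (ContinuousLinearMap.fst ℝ ℝ ℝ)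

@[simp]
lemma rot_apply (a : Plane) : rot a = (-a.2, a.1) := rfl

/-- Pointwise application of `rot`. -/
def rotC : C0 →L[ℝ] C0 := rot.compLeftContinuous ℝ unitInterval

@[simp]
lemma rotC_apply (E : C0) (u : unitInterval) : rotC E u = rot (E u) := rfl

lemma fderiv_rot (φ : Plane → ℝ) (x a : Plane) :
    fderiv ℝ φ x (rot a) = d2 φ x * a.1 - d1 φ x * a.2 := by
  have : rot a = (-a.2) • ((1, 0) : Plane) + a.1 • ((0, 1) : Plane) := by simp
  rw [this, map_add, map_smul, map_smul, d1, d2]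
  simp only [smul_eq_mul]
  ring

variable (U : Set Plane) (φ : Plane → ℝ)

/-- The pairs `(X, E)` such that `X` has values in `U`. -/
def fieldsIn : Set Fields := {p | path p.1 ∈ valuesIn unitInterval U}

variable {U φ}

lemma isOpen_fieldsIn (hU : IsOpen U) : IsOpen (fieldsIn U) :=
  (isOpen_valuesIn hU).preimage (contDiff_pathL.continuous.comp continuous_fst)

variable (φ) in
/-- `rate` as a continuous function. -/
def rateC (p : Fields) : C(unitInterval, ℝ) :=
  pointwise (ContinuousLinearMap.id ℝ (Plane →L[ℝ] ℝ)) (nemytskii (fderiv ℝ φ) (path p.1))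
    (rotC p.2)

lemma rateC_apply_fderiv (hU : IsOpen U) (hφ : ContDiffOn ℝ ∞ φ U) {p : Fields}
    (hp : p ∈ fieldsIn U) (u : unitInterval) :
    rateC φ p u = fderiv ℝ φ (path p.1 u) (rot (p.2 u)) := by
  rw [rateC, pointwise_apply, nemytskii_apply (hφ.continuousOn_fderiv_of_isOpen hU (by simp)) hp]
  rfl

lemma coe_rateC (hU : IsOpen U) (hφ : ContDiffOn ℝ ∞ φ U) {p : Fields} (hp : p ∈ fieldsIn U) :
    ⇑(rateC φ p) = rate φ p := by
  funext u
  rw [rateC_apply_fderiv hU hφ hp, fderiv_rot, rate]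

lemma contDiffOn_path : ContDiffOn ℝ ∞ (fun p : Fields => path p.1) (fieldsIn U) :=
  (contDiff_pathL.comp contDiff_fst).contDiffOn

lemma contDiffOn_rateC (hU : IsOpen U) (hφ : ContDiffOn ℝ ∞ φ U) :
    ContDiffOn ℝ ∞ (rateC φ) (fieldsIn U) := by
  have h1 : ContDiffOn ℝ ∞ (fun p : Fields => nemytskii (fderiv ℝ φ) (path p.1)) (fieldsIn U) :=
    (contDiffOn_nemytskii hU (hφ.fderiv_of_isOpen hU (by simp))).comp contDiffOn_path
      fun p hp => hp
  exact ((ContinuousLinearMap.contDiff _).comp_contDiffOn h1).clm_apply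
    (rotC.contDiff.comp contDiff_snd).contDiffOn

variable (φ) in
/-- `linH` as a continuous function. -/
def linHC (p : Fields) : C(unitInterval, ℝ) := constL ℝ 1 + primitive ℝ (rateC φ p)

variable (φ) in
/-- `expH` as a continuous function. -/
def expHC (p : Fields) : C(unitInterval, ℝ) := expC (primitive ℝ (rateC φ p))

lemma linHC_apply (hU : IsOpen U) (hφ : ContDiffOn ℝ ∞ φ U) {p : Fields} (hp : p ∈ fieldsIn U)
    (u : unitInterval) : linHC φ p u = linH φ p u := by
  rw [linHC, ContinuousMap.add_apply, primitive_apply, coe_rateC hU hφ hp]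
  rfl

lemma expHC_apply (hU : IsOpen U) (hφ : ContDiffOn ℝ ∞ φ U) {p : Fields} (hp : p ∈ fieldsIn U)
    (u : unitInterval) : expHC φ p u = expH φ p u := by
  rw [expHC, expC_apply, primitive_apply, coe_rateC hU hφ hp]
  rfl

lemma expHC_pos (p : Fields) (u : unitInterval) : 0 < expHC φ p u := by
  rw [expHC, expC_apply]
  exact Real.exp_pos _

@[simp]
lemma linHC_zero_right (p : Fields) : linHC φ p 0 = 1 := by simp [linHC]

@[simp]
lemma expHC_zero_right (p : Fields) : expHC φ p 0 = 1 := by simp [expHC]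

lemma derivOn_linHC (p : Fields) : DerivOn (linHC φ p) (rateC φ p) := by
  have := (derivOn_const (1 : ℝ)).add (derivOn_primitive (rateC φ p))
  rwa [zero_add] at this

lemma derivOn_expHC (p : Fields) : DerivOn (expHC φ p) (scale ℝ (expHC φ p) (rateC φ p)) :=
  (derivOn_primitive (rateC φ p)).exp_comp

lemma contDiffOn_linHC (hU : IsOpen U) (hφ : ContDiffOn ℝ ∞ φ U) :
    ContDiffOn ℝ ∞ (linHC φ) (fieldsIn U) :=
  contDiffOn_const.add ((primitive ℝ).contDiff.comp_contDiffOn (contDiffOn_rateC hU hφ))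

lemma contDiffOn_expHC (hU : IsOpen U) (hφ : ContDiffOn ℝ ∞ φ U) :
    ContDiffOn ℝ ∞ (expHC φ) (fieldsIn U) :=
  contDiff_expC.comp_contDiffOn
    ((primitive ℝ).contDiff.comp_contDiffOn (contDiffOn_rateC hU hφ))

variable (U φ) in
/-- The pairs `(X, E)` such that `X` has values in `U` and `linH` is positive. -/
def positiveFields : Set Fields :=
  fieldsIn U ∩ linHC φ ⁻¹' valuesIn unitInterval (Ioi 0)

lemma isOpen_positiveFields (hU : IsOpen U) (hφ : ContDiffOn ℝ ∞ φ U) :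
    IsOpen (positiveFields U φ) :=
  (contDiffOn_linHC hU hφ).continuousOn.isOpen_inter_preimage (isOpen_fieldsIn hU)
    (isOpen_valuesIn isOpen_Ioi)

lemma rateC_scale (X : C1) (a : C(unitInterval, ℝ)) (η : C0) :
    rateC φ (X, scale Plane a η) = scale ℝ a (rateC φ (X, η)) := by
  ext u
  simp only [rateC, pointwise_apply, scale_apply, rotC_apply, map_smul]

variable (φ) in
/-- The change of variables `(X, η) ↦ (X, E)`, `E = H η`. -/
def toE (p : Fields) : Fields := (p.1, scale Plane (expHC φ p) p.2)

variable (φ) in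
/-- The change of variables `(X, E) ↦ (X, η)`, `η = H⁻¹ E`. -/
def toEta (p : Fields) : Fields := (p.1, scale Plane (invC (linHC φ p)) p.2)

/-- The rate is linear in the second field, so the rate of `(X, H η)` is `H T = H'`; integrating
from `H(0) = 1` gives the claim. -/
lemma linHC_toE (p : Fields) : linHC φ (toE φ p) = expHC φ p := by
  ext u
  rw [(derivOn_expHC p).eq_primitive u, expHC_zero_right, linHC, toE, rateC_scale]
  rfl

/-- The affine `H` of `(X, E)` has as derivative the rate of `E = H η`, namely `H` times the rate of
`η`. It starts at `1`, so it is the exponential of the integrated rate of `η`. -/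
lemma expHC_toEta {p : Fields} (hp : linHC φ p ∈ valuesIn unitInterval (Ioi (0 : ℝ))) :
    expHC φ (toEta φ p) = linHC φ p := by
  ext u
  rw [(derivOn_linHC p).eq_exp_primitive (T := rateC φ (toEta φ p)) (fun v => ?_)
    (linHC_zero_right p) u, expHC, expC_apply]
  rw [toEta, rateC_scale, scale_apply, invC_apply hp, smul_eq_mul, mul_comm, ← mul_assoc,
    mul_inv_cancel₀ (hp v).ne', one_mul]

lemma contDiffOn_toE (hU : IsOpen U) (hφ : ContDiffOn ℝ ∞ φ U) :
    ContDiffOn ℝ ∞ (toE φ) (fieldsIn U) := by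
  refine contDiffOn_fst.prodMk ?_
  exact ((scale Plane).contDiff.comp_contDiffOn (contDiffOn_expHC hU hφ)).clm_apply contDiffOn_snd

lemma contDiffOn_toEta (hU : IsOpen U) (hφ : ContDiffOn ℝ ∞ φ U) :
    ContDiffOn ℝ ∞ (toEta φ) (positiveFields U φ) := by
  refine contDiffOn_fst.prodMk ?_
  exact ((scale Plane).contDiff.comp_contDiffOn (contDiffOn_invC.comp
    ((contDiffOn_linHC hU hφ).mono inter_subset_left) fun p hp => hp.2)).clm_apply contDiffOn_snd

variable (U φ) in
/-- The change of variables `(X, η) ↦ (X, H η)` as a diffeomorphism. -/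
def toEHomeo (hU : IsOpen U) (hφ : ContDiffOn ℝ ∞ φ U) : OpenPartialHomeomorph Fields Fields where
  toFun := toE φ
  invFun := toEta φ
  source := fieldsIn U
  target := positiveFields U φ
  map_source' p hp := ⟨hp, fun u => by rw [linHC_toE]; exact expHC_pos p u⟩
  map_target' p hp := hp.1
  left_inv' p hp := by
    refine Prod.ext rfl (ContinuousMap.ext fun u => ?_)
    have h : linHC φ (toE φ p) ∈ valuesIn unitInterval (Ioi (0 : ℝ)) := fun u => by
      rw [linHC_toE]
      exact expHC_pos p u
    change invC (linHC φ (toE φ p)) u • (expHC φ p u • p.2 u) = p.2 u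
    rw [invC_apply h, linHC_toE, smul_smul, inv_mul_cancel₀ (expHC_pos p u).ne', one_smul]
  right_inv' p hp := by
    refine Prod.ext rfl (ContinuousMap.ext fun u => ?_)
    change expHC φ (toEta φ p) u • (invC (linHC φ p) u • p.2 u) = p.2 u
    rw [expHC_toEta hp.2, invC_apply hp.2, smul_smul, mul_inv_cancel₀ (hp.2 u).ne', one_smul]
  open_source := isOpen_fieldsIn hU
  open_target := isOpen_positiveFields hU hφ
  continuousOn_toFun := (contDiffOn_toE hU hφ).continuousOn
  continuousOn_invFun := (contDiffOn_toEta hU hφ).continuousOn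

variable (φ) in
/-- The chart `(X, E) ↦ (X(0), E, X' - φ(X(0)) J E)`. -/
def toSlice (p : Fields) : (Plane × C0) × C0 :=
  ((path p.1 0, p.2), dpath p.1 - φ (path p.1 0) • rotC p.2)

variable (φ) in
/-- The inverse of `toSlice`. -/
def ofSlice (z : (Plane × C0) × C0) : Fields :=
  (mkC1 (z.1.1, z.2 + φ z.1.1 • rotC z.1.2), z.1.2)

lemma contDiffOn_toSlice (hφ : ContDiffOn ℝ ∞ φ U) : ContDiffOn ℝ ∞ (toSlice φ) (fieldsIn U) := by
  have h0 : ContDiffOn ℝ ∞ (fun p : Fields => path p.1 0) (fieldsIn U) :=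
    (evalL Plane 0).contDiff.comp_contDiffOn contDiffOn_path
  have h1 : ContDiffOn ℝ ∞ (fun p : Fields => φ (path p.1 0)) (fieldsIn U) :=
    hφ.comp h0 fun p hp => hp 0
  have h2 : ContDiffOn ℝ ∞ (fun p : Fields => rotC p.2) (fieldsIn U) :=
    (rotC.contDiff.comp contDiff_snd).contDiffOn
  exact (h0.prodMk contDiffOn_snd).prodMk
    ((contDiff_dpathL.comp contDiff_fst).contDiffOn.sub (h1.smul h2))

lemma contDiffOn_ofSlice (hφ : ContDiffOn ℝ ∞ φ U) :
    ContDiffOn ℝ ∞ (ofSlice φ) {z | z.1.1 ∈ U} := by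
  have h0 : ContDiffOn ℝ ∞ (fun z : (Plane × C0) × C0 => φ z.1.1) {z | z.1.1 ∈ U} :=
    hφ.comp (contDiff_fst.comp contDiff_fst).contDiffOn fun z hz => hz
  refine ContDiffOn.prodMk (contDiff_mkC1.comp_contDiffOn ?_)
    (contDiff_snd.comp contDiff_fst).contDiffOn
  exact (contDiff_fst.comp contDiff_fst).contDiffOn.prodMk (contDiffOn_snd.add
    (h0.smul (rotC.contDiff.comp (contDiff_snd.comp contDiff_fst)).contDiffOn))

lemma path_ofSlice_zero (z : (Plane × C0) × C0) : path (ofSlice φ z).1 0 = z.1.1 := by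
  simp [ofSlice]

variable (U φ) in
/-- The chart `toSlice` on `positiveFields`. -/
def sliceHomeo (hU : IsOpen U) (hφ : ContDiffOn ℝ ∞ φ U) :
    OpenPartialHomeomorph Fields ((Plane × C0) × C0) where
  toFun := toSlice φ
  invFun := ofSlice φ
  source := positiveFields U φ
  target := {z | z.1.1 ∈ U} ∩ ofSlice φ ⁻¹' positiveFields U φ
  map_source' p hp := by
    have : ofSlice φ (toSlice φ p) = p := Prod.ext (by simp [ofSlice, toSlice, mkC1_eq]) rfl
    refine ⟨hp.1 0, ?_⟩
    rw [mem_preimage, this]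
    exact hp
  map_target' z hz := hz.2
  left_inv' p hp := Prod.ext (by simp [ofSlice, toSlice, mkC1_eq]) rfl
  right_inv' z hz := by
    refine Prod.ext (Prod.ext (path_ofSlice_zero z) rfl) ?_
    rw [toSlice, path_ofSlice_zero]
    simp [ofSlice]
  open_source := isOpen_positiveFields hU hφ
  open_target := (contDiffOn_ofSlice hφ).continuousOn.isOpen_inter_preimage
    (hU.preimage (continuous_fst.comp continuous_fst)) (isOpen_positiveFields hU hφ)
  continuousOn_toFun := ((contDiffOn_toSlice hφ).mono inter_subset_left).continuousOn
  continuousOn_invFun := ((contDiffOn_ofSlice hφ).mono inter_subset_left).continuousOn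

lemma mem_modifiedSolutions_iff (hU : IsOpen U) (hφ : ContDiffOn ℝ ∞ φ U) (p : Fields) :
    p ∈ modifiedSolutions U φ ↔ p ∈ positiveFields U φ ∧
      dpath p.1 = φ (path p.1 0) • rotC p.2 := by
  constructor
  · intro h
    have h1 : p ∈ fieldsIn U := fun u => (h u).1
    refine ⟨⟨h1, fun u => ?_⟩, ContinuousMap.ext fun u => Prod.ext ?_ ?_⟩
    · rw [linHC_apply hU hφ h1]
      exact (h u).2.2.2
    · have := (h u).2.1
      simp only [ContinuousMap.smul_apply, rotC_apply, rot_apply, Prod.smul_fst, smul_eq_mul]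
      linarith
    · have := (h u).2.2.1
      simp only [ContinuousMap.smul_apply, rotC_apply, rot_apply, Prod.smul_snd, smul_eq_mul]
      linarith
  · rintro ⟨h1, h2⟩ u
    refine ⟨h1.1 u, ?_, ?_, ?_⟩
    · simp [h2]
    · simp [h2]
    · rw [← linHC_apply hU hφ h1.1]
      exact h1.2 u

lemma mem_gaussSolutions_iff (p : Fields) :
    p ∈ gaussSolutions U φ ↔ p ∈ fieldsIn U ∧
      ∀ u, dpath p.1 u = φ (path p.1 u) • rot (p.2 u) := by
  constructor
  · intro h
    refine ⟨fun u => (h u).1, fun u => Prod.ext ?_ ?_⟩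
    · have := (h u).2.1
      simp only [rot_apply, Prod.smul_fst, smul_eq_mul]
      linarith
    · have := (h u).2.2
      simp only [rot_apply, Prod.smul_snd, smul_eq_mul]
      linarith
  · rintro ⟨h1, h2⟩ u
    refine ⟨h1 u, ?_, ?_⟩ <;> simp [h2]

/-- `φ` along a curve, with its derivative. -/
lemma derivOn_comp_path (hU : IsOpen U) (hφ : ContDiffOn ℝ ∞ φ U) {p : Fields}
    (hp : p ∈ fieldsIn U) {a : C(unitInterval, ℝ)}
    (h : ∀ u, dpath p.1 u = a u • rot (p.2 u)) :
    DerivOn (nemytskii φ (path p.1)) (scale ℝ a (rateC φ p)) := by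
  convert (derivOn_path p.1).comp hU hφ hp using 1
  ext u
  simp only [scale_apply, rateC, pointwise_apply, ContinuousLinearMap.coe_id', id_eq, h u,
    map_smul, rotC_apply]

/-- Along a solution of the modified equations, `φ(X(u)) = φ(X(0)) H(u)`. -/
lemma phi_path_of_modified (hU : IsOpen U) (hφ : ContDiffOn ℝ ∞ φ U) {p : Fields}
    (hp : p ∈ fieldsIn U) (h : dpath p.1 = φ (path p.1 0) • rotC p.2) (u : unitInterval) :
    φ (path p.1 u) = φ (path p.1 0) * linHC φ p u := by
  have h1 := (derivOn_comp_path hU hφ hp (a := constL ℝ (φ (path p.1 0)))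
    (fun u => by rw [h]; rfl)).eq_primitive u
  rw [nemytskii_apply hφ.continuousOn hp, nemytskii_apply hφ.continuousOn hp] at h1
  -- The derivative of `φ(X)` is the constant `φ(X(0))` times the rate, so `φ(X)` is obtained by
  -- integration.
  have h2 : scale ℝ (constL ℝ (φ (path p.1 0))) (rateC φ p) = φ (path p.1 0) • rateC φ p := rfl
  rw [h1, h2, map_smul, linHC]
  simp
  ring

/-- Along a solution of the Gauss law, `φ(X(u)) = φ(X(0)) H(u)`. -/
lemma phi_path_of_gauss (hU : IsOpen U) (hφ : ContDiffOn ℝ ∞ φ U) {p : Fields}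
    (hp : p ∈ fieldsIn U) (h : ∀ u, dpath p.1 u = φ (path p.1 u) • rot (p.2 u))
    (u : unitInterval) : φ (path p.1 u) = φ (path p.1 0) * expHC φ p u := by
  have h1 := derivOn_comp_path hU hφ hp (a := nemytskii φ (path p.1))
    (fun u => by rw [h, nemytskii_apply hφ.continuousOn hp])
  have h2 : scale ℝ (nemytskii φ (path p.1)) (rateC φ p) =
      scale ℝ (rateC φ p) (nemytskii φ (path p.1)) := by
    ext u
    simp [mul_comm]
  rw [h2] at h1
  -- Here `φ(X)` itself solves the linear equation `g' = T g`.
  have h3 := h1.eq_mul_exp u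
  rw [nemytskii_apply hφ.continuousOn hp, nemytskii_apply hφ.continuousOn hp] at h3
  rw [h3, expHC, expC_apply]

/-- `toE` maps the solutions of the Gauss law to the solutions of the modified equations. -/
lemma toE_mem_iff (hU : IsOpen U) (hφ : ContDiffOn ℝ ∞ φ U) {p : Fields} (hp : p ∈ fieldsIn U) :
    toE φ p ∈ modifiedSolutions U φ ↔ p ∈ gaussSolutions U φ := by
  rw [mem_modifiedSolutions_iff hU hφ, mem_gaussSolutions_iff]
  have hE : toE φ p ∈ positiveFields U φ := (toEHomeo U φ hU hφ).map_source hp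
  -- The right-hand sides of the two equations agree as soon as `φ(X(u)) = φ(X(0)) H(u)`, and either
  -- equation implies that relation.
  have key : ∀ u, (φ (path p.1 0) • rotC (toE φ p).2) u =
      (φ (path p.1 0) * expHC φ p u) • rot (p.2 u) := fun u => by
    change φ (path p.1 0) • rot (expHC φ p u • p.2 u) = _
    rw [map_smul, smul_smul]
  constructor
  · rintro ⟨-, h⟩
    refine ⟨hp, fun u => ?_⟩
    have h2 := phi_path_of_modified hU hφ hE.1 h u
    rw [linHC_toE] at h2
    change φ (path p.1 u) = φ (path p.1 0) * _ at h2
    change dpath p.1 = φ (path p.1 0) • rotC (toE φ p).2 at h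
    rw [h, key, h2]
  · rintro ⟨-, h⟩
    refine ⟨hE, ContinuousMap.ext fun u => ?_⟩
    change dpath p.1 u = (φ (path p.1 0) • rotC (toE φ p).2) u
    rw [h, key, ← phi_path_of_gauss hU hφ hp h]

end Rates

/-! ### Symplectic leaves in the regular set -/

section Leaves

variable {U : Set Plane} {φ : Plane → ℝ}

/-- The set where the Poisson structure does not vanish. -/
def regularSet (U : Set Plane) (φ : Plane → ℝ) : Set Plane := {y | y ∈ U ∧ φ y ≠ 0}

lemma isOpen_regularSet (hU : IsOpen U) (hφ : ContDiffOn ℝ ∞ φ U) : IsOpen (regularSet U φ) :=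
  hφ.continuousOn.isOpen_inter_preimage hU isOpen_ne

lemma fderiv_eq_d1_d2 (f : Plane → ℝ) (x a : Plane) :
    fderiv ℝ f x a = a.1 * d1 f x + a.2 * d2 f x := by
  have : a = a.1 • ((1, 0) : Plane) + a.2 • ((0, 1) : Plane) := by simp
  conv_lhs => rw [this, map_add, map_smul, map_smul]
  rfl

lemma continuousOn_d1 (hU : IsOpen U) {f : Plane → ℝ} (hf : ContDiffOn ℝ ∞ f U) :
    ContinuousOn (d1 f) U :=
  (hf.continuousOn_fderiv_of_isOpen hU (by simp)).clm_apply continuousOn_const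

lemma continuousOn_d2 (hU : IsOpen U) {f : Plane → ℝ} (hf : ContDiffOn ℝ ∞ f U) :
    ContinuousOn (d2 f) U :=
  (hf.continuousOn_fderiv_of_isOpen hU (by simp)).clm_apply continuousOn_const

/-- Hamiltonian flows multiply the Poisson structure function by a positive factor. -/
lemma HamiltonianArc.exists_exp (hU : IsOpen U) (hφ : ContDiffOn ℝ ∞ φ U) {x y : Plane}
    (h : HamiltonianArc U φ x y) : y ∈ U ∧ ∃ c, φ y = φ x * Real.exp c := by
  obtain ⟨f, γ, hf, rfl, rfl, hγ⟩ := h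
  have hγU : ∀ t ∈ Icc (0 : ℝ) 1, γ t ∈ U := fun t ht => (hγ t ht).1
  refine ⟨hγU 1 (by simp), ?_⟩
  have hγc : ContinuousOn γ (Icc 0 1) := fun t ht => (hγ t ht).2.continuousWithinAt
  let g : C(unitInterval, Plane) := ⟨fun u => γ u, hγc.domRestrict⟩
  have hg : g ∈ valuesIn unitInterval U := fun u => hγU u u.2
  have hcomp : ∀ {k : Plane → ℝ}, ContinuousOn k U → Continuous fun u => k (g u) :=
    fun hk => hk.comp_continuous g.continuous hg
  -- Since the Hamiltonian field carries a factor `φ`, the derivative of `φ` along it is `φ T`: a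
  -- linear equation, whose solutions change by an exponential factor.
  let T : C(unitInterval, ℝ) :=
    ⟨fun u => d1 φ (g u) * d2 f (g u) - d2 φ (g u) * d1 f (g u),
      ((hcomp (continuousOn_d1 hU hφ)).mul (hcomp (continuousOn_d2 hU hf))).sub
        ((hcomp (continuousOn_d2 hU hφ)).mul (hcomp (continuousOn_d1 hU hf)))⟩
  let g' : C(unitInterval, Plane) := ⟨fun u => hamiltonianField φ f (g u),
    ((hcomp hφ.continuousOn).mul (hcomp (continuousOn_d2 hU hf))).prodMk
      ((hcomp hφ.continuousOn).mul (hcomp (continuousOn_d1 hU hf))).neg⟩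
  have hgg' : DerivOn g g' := fun u => by
    refine (hγ u u.2).2.congr (fun v hv => ?_) ?_
    · rw [IccExtend_of_mem _ _ hv]
      rfl
    · rw [IccExtend_val]
      rfl
  have h1 := hgg'.comp hU hφ hg
  have e : pointwise (ContinuousLinearMap.id ℝ (Plane →L[ℝ] ℝ)) (nemytskii (fderiv ℝ φ) g) g' =
      scale ℝ T (nemytskii φ g) := by
    ext u
    rw [pointwise_apply, nemytskii_apply (hφ.continuousOn_fderiv_of_isOpen hU (by simp)) hg,
      scale_apply, nemytskii_apply hφ.continuousOn hg, ContinuousLinearMap.id_apply,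
      fderiv_eq_d1_d2]
    change φ (g u) * d2 f (g u) * d1 φ (g u) + -(φ (g u) * d1 f (g u)) * d2 φ (g u) =
      (d1 φ (g u) * d2 f (g u) - d2 φ (g u) * d1 f (g u)) * φ (g u)
    ring
  rw [e] at h1
  have h2 := h1.eq_mul_exp 1
  rw [nemytskii_apply hφ.continuousOn hg, nemytskii_apply hφ.continuousOn hg] at h2
  exact ⟨_, h2⟩

/-- A smooth function that agrees with `t ↦ t⁻¹` for `|t| ≥ c`. -/
lemma exists_contDiff_eq_inv {c : ℝ} (hc : 0 < c) :
    ∃ κ : ℝ → ℝ, ContDiff ℝ ∞ κ ∧ ∀ t, c ≤ |t| → κ t = t⁻¹ := by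
  -- The cutoff vanishes for `(t/c)² ≤ 1/2`, which removes the pole, and equals `1` for `|t| ≥ c`.
  refine ⟨fun t => Real.smoothTransition (2 * (t / c) ^ 2 - 1) * t⁻¹, ?_, fun t ht => ?_⟩
  · rw [contDiff_iff_contDiffAt]
    intro t
    rcases eq_or_ne t 0 with rfl | ht
    · have h : ∀ᶠ s : ℝ in 𝓝 0, 2 * (s / c) ^ 2 - 1 < 0 := by
        have hcont : Continuous fun s : ℝ => 2 * (s / c) ^ 2 - 1 := by fun_prop
        exact hcont.continuousAt.eventually_lt continuousAt_const (by norm_num)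
      refine (contDiffAt_const (c := (0 : ℝ))).congr_of_eventuallyEq ?_
      filter_upwards [h] with s hs
      rw [Real.smoothTransition.zero_of_nonpos hs.le, zero_mul]
    · refine ContDiffAt.mul ?_ (contDiffAt_inv ℝ ht)
      exact (Real.smoothTransition.contDiff.comp (by fun_prop)).contDiffAt
  · have h1 : 1 ≤ |t / c| := by
      rw [abs_div, abs_of_pos hc]
      exact (one_le_div hc).2 ht
    have h2 : 1 ≤ (t / c) ^ 2 := by
      rw [← sq_abs]
      exact one_le_pow₀ h1
    change Real.smoothTransition (2 * (t / c) ^ 2 - 1) * t⁻¹ = t⁻¹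
    rw [Real.smoothTransition.one_of_one_le (by linarith), one_mul]

/-- Segments in the regular set are integral curves of Hamiltonian vector fields. -/
lemma hamiltonianArc_of_segment (hU : IsOpen U) (hφ : ContDiffOn ℝ ∞ φ U) {y z : Plane}
    (h : segment ℝ y z ⊆ regularSet U φ) : HamiltonianArc U φ y z := by
  have hcomp : IsCompact (segment ℝ y z) := by
    rw [segment_eq_image_lineMap]
    exact isCompact_Icc.image (AffineMap.lineMap_continuous)
  have hcont : ContinuousOn (fun w => |φ w|) (segment ℝ y z) :=
    (hφ.continuousOn.mono fun w hw => (h hw).1).abs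
  obtain ⟨w₀, hw₀, hmin⟩ := hcomp.exists_isMinOn ⟨y, left_mem_segment ℝ y z⟩ hcont
  obtain ⟨κ, hκ, hκinv⟩ := exists_contDiff_eq_inv (abs_pos.2 (h hw₀).2)
  -- The form `ℓ` generates the constant direction `z - y` and vanishes along it. The Hamiltonian
  -- `ℓ(w - y) κ(φ w)` is smooth on all of `U`; on the segment its differential is `φ⁻¹ ℓ`, because
  -- the term with `dκ` carries the factor `ℓ(w - y) = 0`. The factor `φ` of the bivector then
  -- cancels.
  set ℓ : Plane →L[ℝ] ℝ := (z - y).1 • ContinuousLinearMap.snd ℝ ℝ ℝ -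
    (z - y).2 • ContinuousLinearMap.fst ℝ ℝ ℝ with hℓ
  have hκφ : ContDiffOn ℝ ∞ (fun w => κ (φ w)) U := hκ.comp_contDiffOn hφ
  refine ⟨fun w => ℓ (w - y) * κ (φ w), fun t => y + t • (z - y), ?_, by simp, by simp,
    fun t ht => ?_⟩
  · exact ((ℓ.contDiff.comp (contDiff_id.sub contDiff_const)).contDiffOn).mul hκφ
  · have hmem : y + t • (z - y) ∈ segment ℝ y z := by
      rw [segment_eq_image']
      exact ⟨t, ht, rfl⟩
    set w := y + t • (z - y) with hw
    obtain ⟨hwU, hw0⟩ := h hmem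
    refine ⟨hwU, ?_⟩
    have hℓw : ℓ (w - y) = 0 := by
      have : ℓ (z - y) = (z - y).1 * (z - y).2 - (z - y).2 * (z - y).1 := rfl
      rw [hw, add_sub_cancel_left, map_smul, this, mul_comm, sub_self, smul_zero]
    have h1 : HasFDerivAt (fun w => ℓ (w - y)) ℓ w :=
      ℓ.hasFDerivAt.comp w ((hasFDerivAt_id w).sub_const y)
    have h2 : HasFDerivAt (fun w => κ (φ w)) (fderiv ℝ (fun w => κ (φ w)) w) w :=
      ((hκφ.differentiableOn (by simp)).differentiableAt (hU.mem_nhds hwU)).hasFDerivAt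
    have h3 := (h1.mul h2).fderiv
    rw [hℓw, zero_smul, zero_add, hκinv _ (hmin hmem)] at h3
    have h4 : hamiltonianField φ (fun w => ℓ (w - y) * κ (φ w)) w = z - y := by
      have h3' : fderiv ℝ (fun w => ℓ (w - y) * κ (φ w)) w = (φ w)⁻¹ • ℓ := h3
      rw [hamiltonianField, d1, d2, h3']
      ext
      · simp [hℓ, hw0]
      · simp [hℓ, hw0]
    rw [h4]
    simpa using ((hasDerivAt_id t).smul_const (z - y)).const_add y |>.hasDerivWithinAt

variable {x : Plane}

lemma self_mem_leaf : x ∈ symplecticLeaf U φ x := Relation.ReflTransGen.refl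

lemma exists_exp_of_mem_leaf (hU : IsOpen U) (hφ : ContDiffOn ℝ ∞ φ U) (hx : x ∈ U) {y : Plane}
    (hy : y ∈ symplecticLeaf U φ x) : y ∈ U ∧ ∃ c, φ y = φ x * Real.exp c := by
  induction hy with
  | refl => exact ⟨hx, 0, by simp⟩
  | tail _ h ih =>
    obtain ⟨-, c, hc⟩ := ih
    obtain ⟨hU', c', hc'⟩ := h.exists_exp hU hφ
    exact ⟨hU', c + c', by rw [hc', hc, Real.exp_add, mul_assoc]⟩

lemma div_pos_of_mem_leaf (hU : IsOpen U) (hφ : ContDiffOn ℝ ∞ φ U) (hx : x ∈ regularSet U φ)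
    {y : Plane} (hy : y ∈ symplecticLeaf U φ x) : 0 < φ y / φ x := by
  obtain ⟨-, c, hc⟩ := exists_exp_of_mem_leaf hU hφ hx.1 hy
  rw [hc, mul_div_cancel_left₀ _ hx.2]
  exact Real.exp_pos c

lemma leaf_subset_regularSet (hU : IsOpen U) (hφ : ContDiffOn ℝ ∞ φ U)
    (hx : x ∈ regularSet U φ) : symplecticLeaf U φ x ⊆ regularSet U φ := fun y hy => by
  obtain ⟨hyU, c, hc⟩ := exists_exp_of_mem_leaf hU hφ hx.1 hy
  refine ⟨hyU, ?_⟩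
  rw [hc]
  exact mul_ne_zero hx.2 (Real.exp_ne_zero c)

/-- Segments in a small ball can be run both ways. The outgoing arcs make a leaf open, the incoming
ones make its complement in the regular set open. -/
lemma exists_ball_hamiltonianArc (hU : IsOpen U) (hφ : ContDiffOn ℝ ∞ φ U) {y : Plane}
    (hy : y ∈ regularSet U φ) : ∃ r > 0, Metric.ball y r ⊆ regularSet U φ ∧
      ∀ z ∈ Metric.ball y r, HamiltonianArc U φ y z ∧ HamiltonianArc U φ z y := by
  obtain ⟨r, hr, hball⟩ := Metric.isOpen_iff.1 (isOpen_regularSet hU hφ) y hy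
  refine ⟨r, hr, hball, fun z hz => ⟨?_, ?_⟩⟩ <;>
    refine hamiltonianArc_of_segment hU hφ (((convex_ball y r).segment_subset ?_ ?_).trans hball)
  exacts [Metric.mem_ball_self hr, hz, hz, Metric.mem_ball_self hr]

lemma isOpen_leaf (hU : IsOpen U) (hφ : ContDiffOn ℝ ∞ φ U) (hx : x ∈ regularSet U φ) :
    IsOpen (symplecticLeaf U φ x) := by
  refine Metric.isOpen_iff.2 fun y hy => ?_
  obtain ⟨r, hr, -, h⟩ :=
    exists_ball_hamiltonianArc hU hφ (leaf_subset_regularSet hU hφ hx hy)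
  exact ⟨r, hr, fun z hz => hy.tail (h z hz).1⟩

lemma isOpen_diff_leaf (hU : IsOpen U) (hφ : ContDiffOn ℝ ∞ φ U) :
    IsOpen (regularSet U φ \ symplecticLeaf U φ x) := by
  refine Metric.isOpen_iff.2 fun y hy => ?_
  obtain ⟨r, hr, hball, h⟩ := exists_ball_hamiltonianArc hU hφ hy.1
  exact ⟨r, hr, fun z hz => ⟨hball hz, fun hzx => hy.2 (hzx.tail (h z hz).2)⟩⟩

/-- A leaf contains every preconnected subset of the regular set that it meets. -/
lemma IsPreconnected.subset_leaf (hU : IsOpen U) (hφ : ContDiffOn ℝ ∞ φ U)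
    (hx : x ∈ regularSet U φ) {t : Set Plane} (ht : IsPreconnected t)
    (htN : t ⊆ regularSet U φ) (hmeet : (t ∩ symplecticLeaf U φ x).Nonempty) :
    t ⊆ symplecticLeaf U φ x := by
  refine ht.subset_left_of_subset_union (isOpen_leaf hU hφ hx)
    (isOpen_diff_leaf (x := x) hU hφ) disjoint_sdiff_right (fun y hy => ?_) hmeet
  by_cases h : y ∈ symplecticLeaf U φ x
  exacts [Or.inl h, Or.inr ⟨htN hy, h⟩]

end Leaves

/-! ### Approximation by `C¹` curves with fixed end points -/

section Approximation

/-- A polynomial as a continuous function on `[0, 1]`. -/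
def polyC (q : Polynomial ℝ) : C(unitInterval, ℝ) := ⟨fun u => q.eval (u : ℝ), by fun_prop⟩

@[simp]
lemma polyC_apply (q : Polynomial ℝ) (u : unitInterval) : polyC q u = q.eval (u : ℝ) := rfl

lemma derivOn_polyC (q : Polynomial ℝ) : DerivOn (polyC q) (polyC q.derivative) := fun u => by
  refine (q.hasDerivAt (u : ℝ)).hasDerivWithinAt.congr (fun v hv => ?_) ?_
  · rw [IccExtend_of_mem _ _ hv]
    rfl
  · rw [IccExtend_val]
    rfl

/-- Polynomials approximate continuous functions, with the same end points. -/
lemma exists_polynomial_near_same_ends (f : C(unitInterval, ℝ)) {ε : ℝ} (hε : 0 < ε) :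
    ∃ q : Polynomial ℝ, q.eval 0 = f 0 ∧ q.eval 1 = f 1 ∧
      ∀ u : unitInterval, |q.eval (u : ℝ) - f u| < ε := by
  obtain ⟨p, hp⟩ := exists_polynomial_near_of_continuousOn 0 1 (IccExtend (zero_le_one' ℝ) f)
    (continuous_iccExtend f).continuousOn (ε / 2) (half_pos hε)
  have hp' : ∀ u : unitInterval, |p.eval (u : ℝ) - f u| < ε / 2 := fun u => by
    have := hp u u.2
    rwa [IccExtend_val] at this
  have h0 := hp' 0
  have h1 := hp' 1
  simp only [Icc.coe_zero, Icc.coe_one] at h0 h1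
  set a := f 0 - p.eval 0 with ha
  set b := f 1 - p.eval 1 with hb
  -- The affine correction repairs the errors `a`, `b` at the ends. Both are at most `ε/2`, hence so
  -- is the correction throughout.
  refine ⟨p + ((1 - Polynomial.X) * Polynomial.C a + Polynomial.X * Polynomial.C b),
    by simp [ha], by simp [hb], fun u => ?_⟩
  have h2 := hp' u
  have hu := u.2
  have e : Polynomial.eval (u : ℝ) (p + ((1 - Polynomial.X) * Polynomial.C a +
      Polynomial.X * Polynomial.C b)) - f u = (p.eval (u : ℝ) - f u) +
        ((1 - (u : ℝ)) * a + u * b) := by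
    simp
    ring
  rw [e]
  have ha' : |a| ≤ ε / 2 := by rw [ha, abs_sub_comm]; exact h0.le
  have hb' : |b| ≤ ε / 2 := by rw [hb, abs_sub_comm]; exact h1.le
  have h3 : |(1 - (u : ℝ)) * a + u * b| ≤ ε / 2 := by
    refine (abs_add_le _ _).trans ?_
    rw [abs_mul, abs_mul, abs_of_nonneg hu.1, abs_of_nonneg (sub_nonneg.2 hu.2)]
    nlinarith [hu.1, hu.2]
  calc _ ≤ _ := abs_add_le _ _
    _ < ε := by linarith

/-- `C¹` curves approximate continuous curves, with the same end points. -/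
lemma exists_C1_near_same_ends (σ : C0) {ε : ℝ} (hε : 0 < ε) :
    ∃ X : C1, path X 0 = σ 0 ∧ path X 1 = σ 1 ∧ ∀ u, dist (path X u) (σ u) < ε := by
  obtain ⟨q, hq0, hq1, hq⟩ :=
    exists_polynomial_near_same_ends ((ContinuousLinearMap.fst ℝ ℝ ℝ).compLeftContinuous ℝ _ σ) hε
  obtain ⟨r, hr0, hr1, hr⟩ :=
    exists_polynomial_near_same_ends ((ContinuousLinearMap.snd ℝ ℝ ℝ).compLeftContinuous ℝ _ σ) hε
  refine ⟨⟨((polyC q).prodMk (polyC r), (polyC q.derivative).prodMk (polyC r.derivative)),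
    fun u => (derivOn_polyC q u).prodMk (derivOn_polyC r u)⟩, Prod.ext ?_ ?_, Prod.ext ?_ ?_,
    fun u => ?_⟩
  · exact hq0
  · exact hr0
  · exact hq1
  · exact hr1
  · exact max_lt (hq u) (hr u)

end Approximation

/-! ### Homotopies made of straight pieces -/

section Homotopy

variable {L : Set Plane}

/-- In an open simply connected set, `C¹` curves with the same end points are joined by finitely
many straight homotopies. -/
theorem eq_of_straight_homotopies (hL : IsOpen L) [SimplyConnectedSpace L] {β : Type}
    (a b : Plane) (c : C1 → β)
    (hc : ∀ X Y : C1, path X 0 = a → path X 1 = b → path Y 0 = a → path Y 1 = b →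
      (∀ s ∈ Icc (0 : ℝ) 1, ∀ u, path X u + s • (path Y u - path X u) ∈ L) → c X = c Y)
    {X Y : C1} (hX : path X ∈ valuesIn unitInterval L) (hY : path Y ∈ valuesIn unitInterval L)
    (hX0 : path X 0 = a) (hX1 : path X 1 = b) (hY0 : path Y 0 = a) (hY1 : path Y 1 = b) :
    c X = c Y := by
  subst hX0 hX1
  let γ : Path (⟨path X 0, hX 0⟩ : L) ⟨path X 1, hX 1⟩ :=
    { toFun := fun u => ⟨path X u, hX u⟩
      continuous_toFun := (path X).continuous.subtype_mk _
      source' := rfl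
      target' := rfl }
  let γ' : Path (⟨path X 0, hX 0⟩ : L) ⟨path X 1, hX 1⟩ :=
    { toFun := fun u => ⟨path Y u, hY u⟩
      continuous_toFun := (path Y).continuous.subtype_mk _
      source' := Subtype.ext hY0
      target' := Subtype.ext hY1 }
  obtain ⟨F⟩ := SimplyConnectedSpace.paths_homotopic γ γ'
  let F₀ : C(unitInterval × unitInterval, Plane) :=
    ⟨fun z => (F z : Plane), continuous_subtype_val.comp F.continuous⟩
  have hF : ∀ z, F₀ z ∈ L := fun z => (F z).2
  have hF0 : ∀ s, F₀ (s, 0) = path X 0 := fun s => congrArg Subtype.val (F.source s)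
  have hF1 : ∀ s, F₀ (s, 1) = path X 1 := fun s => congrArg Subtype.val (F.target s)
  obtain ⟨ε, hε, hεL⟩ := (isCompact_range F₀.continuous).exists_thickening_subset_open hL
    (by rintro _ ⟨z, rfl⟩; exact hF z)
  have hball : ∀ z, Metric.ball (F₀ z) ε ⊆ L := fun z w hw =>
    hεL (Metric.mem_thickening_iff.2 ⟨F₀ z, mem_range_self z, hw⟩)
  -- Each stage of the continuous homotopy is replaced by a `C¹` curve. No regularity in `s` is
  -- needed, since only the value of `c` on it will matter.
  choose A hA0 hA1 hA using fun s => exists_C1_near_same_ends (F₀.curry s) (half_pos hε)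
  have hclose : ∀ s (Z W : C1), path Z 0 = path X 0 → path Z 1 = path X 1 → path W 0 = path X 0 →
      path W 1 = path X 1 → (∀ u, dist (path Z u) (F₀ (s, u)) < ε) →
      (∀ u, dist (path W u) (F₀ (s, u)) < ε) → c Z = c W := by
    intro s Z W hZ0 hZ1 hW0 hW1 hZ hW
    refine hc Z W hZ0 hZ1 hW0 hW1 fun t ht u => hball (s, u) ?_
    -- Two curves close to the same stage are joined pointwise inside a ball, which is convex and
    -- contained in `L`.
    exact (convex_ball (F₀ (s, u)) ε).add_smul_sub_mem (hZ u) (hW u) ht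
  have hA0' : ∀ s, path (A s) 0 = path X 0 := fun s => (hA0 s).trans (hF0 s)
  have hA1' : ∀ s, path (A s) 1 = path X 1 := fun s => (hA1 s).trans (hF1 s)
  have hAε : ∀ s u, dist (path (A s) u) (F₀ (s, u)) < ε := fun s u =>
    (hA s u).trans (half_lt_self hε)
  -- For `t` near `s`, both `A t` and `A s` are within `ε` of stage `s`. Connectedness of the
  -- interval then replaces an explicit subdivision.
  have hconst : IsLocallyConstant fun s => c (A s) := by
    rw [IsLocallyConstant.iff_eventually_eq]
    intro s
    filter_upwards [F₀.curry.continuous.continuousAt.eventually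
      (Metric.ball_mem_nhds (F₀.curry s) (half_pos hε))] with t ht
    refine hclose s _ _ (hA0' t) (hA1' t) (hA0' s) (hA1' s) (fun u => ?_) (hAε s)
    have h1 : dist (F₀.curry t u) (F₀.curry s u) < ε / 2 :=
      (ContinuousMap.dist_apply_le_dist u).trans_lt ht
    calc _ ≤ dist (path (A t) u) (F₀.curry t u) + dist (F₀.curry t u) (F₀ (s, u)) :=
          dist_triangle _ _ _
      _ < ε := by
        have := hA t u
        have h1' : dist (F₀.curry t u) (F₀ (s, u)) < ε / 2 := h1
        linarith
  have e0 : c X = c (A 0) := hclose 0 _ _ rfl rfl (hA0' 0) (hA1' 0) (fun u => by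
    have : F₀ (0, u) = path X u := congrArg Subtype.val (F.apply_zero u)
    rw [this, dist_self]
    exact hε) (hAε 0)
  have e1 : c Y = c (A 1) := hclose 1 _ _ hY0 hY1 (hA0' 1) (hA1' 1) (fun u => by
    have : F₀ (1, u) = path Y u := congrArg Subtype.val (F.apply_one u)
    rw [this, dist_self]
    exact hε) (hAε 1)
  rw [e0, e1]
  exact hconst.apply_eq_of_preconnectedSpace 0 1

/-- In an open path connected set, any two points are joined by a `C¹` curve. -/
lemma exists_C1_joining (hL : IsOpen L) [PathConnectedSpace L] {a b : Plane} (ha : a ∈ L)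
    (hb : b ∈ L) : ∃ X : C1, path X ∈ valuesIn unitInterval L ∧ path X 0 = a ∧ path X 1 = b := by
  let γ : Path (⟨a, ha⟩ : L) ⟨b, hb⟩ := PathConnectedSpace.somePath _ _
  let σ : C0 := ⟨fun u => (γ u : Plane), continuous_subtype_val.comp γ.continuous⟩
  obtain ⟨ε, hε, hεL⟩ := (isCompact_range σ.continuous).exists_thickening_subset_open hL
    (by rintro _ ⟨u, rfl⟩; exact (γ u).2)
  obtain ⟨X, h0, h1, hX⟩ := exists_C1_near_same_ends σ hε
  refine ⟨X, fun u => hεL (Metric.mem_thickening_iff.2 ⟨σ u, mem_range_self u, hX u⟩), ?_, ?_⟩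
  · exact h0.trans (congrArg Subtype.val γ.source)
  · exact h1.trans (congrArg Subtype.val γ.target)

end Homotopy

/-! ### The image of the solution space and its connectedness -/

section Reachable

variable {U : Set Plane} {φ : Plane → ℝ}

lemma primitive_clm {V W : Type} [NormedAddCommGroup V] [NormedSpace ℝ V] [CompleteSpace V]
    [NormedAddCommGroup W] [NormedSpace ℝ W] [CompleteSpace W] (L : V →L[ℝ] W)
    (f : C(unitInterval, V)) (u : unitInterval) :
    primitive W (L.compLeftContinuous ℝ unitInterval f) u = L (primitive V f u) := by
  have h := ((derivOn_primitive f).clm L).eq_primitive u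
  have h0 : L.compLeftContinuous ℝ unitInterval (primitive V f) 0 = 0 := by
    change L (primitive V f 0) = 0
    rw [primitive_zero_right, map_zero]
  rw [h0, zero_add] at h
  exact h.symm

variable (U φ) in
/-- The points `(x, π)` of `positiveSet` such that `x` and `x_f` are in the same leaf. -/
def reachableSet : Set Phase :=
  {z | z ∈ positiveSet U φ ∧ (φ z.1 = 0 ∨ xf φ z ∈ symplecticLeaf U φ z.1)}

lemma xf_eq (z : Phase) : xf φ z = z.1 + φ z.1 • rot z.2 := by
  ext <;> simp [xf, sub_eq_add_neg]

lemma hFun_of_eq_zero {z : Phase} (h : φ z.1 = 0) :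
    hFun φ z = 1 + fderiv ℝ φ z.1 (rot z.2) := by
  rw [hFun, if_pos h, fderiv_rot]
  ring

lemma hFun_of_ne_zero {z : Phase} (h : φ z.1 ≠ 0) : hFun φ z = φ (xf φ z) / φ z.1 := by
  rw [hFun, if_neg h]

/-- The coefficient `φ(X(0))` is constant in `u`, so the equation is solved by integrating `E`. -/
lemma path_of_modified {p : Fields} (h : dpath p.1 = φ (path p.1 0) • rotC p.2)
    (u : unitInterval) : path p.1 u = xf φ (path p.1 0, primitive Plane p.2 u) := by
  rw [(derivOn_path p.1).eq_primitive u, h, map_smul, xf_eq, ContinuousMap.smul_apply, rotC,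
    primitive_clm]

/-- The curve stays at its zero of `φ`, so the rate is a fixed linear functional of `E`. -/
lemma linHC_of_eq_zero (hU : IsOpen U) (hφ : ContDiffOn ℝ ∞ φ U) {p : Fields}
    (hp : p ∈ fieldsIn U) (h : dpath p.1 = φ (path p.1 0) • rotC p.2) (h0 : φ (path p.1 0) = 0)
    (u : unitInterval) :
    linHC φ p u = 1 + fderiv ℝ φ (path p.1 0) (rot (primitive Plane p.2 u)) := by
  have hr : rateC φ p =
      ((fderiv ℝ φ (path p.1 0)).comp rot).compLeftContinuous ℝ unitInterval p.2 := by
    ext v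
    rw [rateC_apply_fderiv hU hφ hp, path_of_modified h, xf_eq]
    simp [h0]
  rw [linHC, hr, ContinuousMap.add_apply, primitive_clm]
  rfl

/-- By `φ(X) = φ(X(0)) H` with `H > 0`, the curve never leaves the regular set, and its range is
connected. -/
lemma path_mem_leaf (hU : IsOpen U) (hφ : ContDiffOn ℝ ∞ φ U) {p : Fields}
    (hp : p ∈ modifiedSolutions U φ) (h0 : φ (path p.1 0) ≠ 0) (u : unitInterval) :
    path p.1 u ∈ symplecticLeaf U φ (path p.1 0) := by
  obtain ⟨hp1, hp2⟩ := (mem_modifiedSolutions_iff hU hφ p).1 hp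
  refine IsPreconnected.subset_leaf hU hφ ⟨hp1.1 0, h0⟩
    (isPreconnected_range (path p.1).continuous) ?_ ⟨path p.1 0, mem_range_self _, self_mem_leaf⟩
    (mem_range_self u)
  rintro _ ⟨v, rfl⟩
  refine ⟨hp1.1 v, ?_⟩
  rw [phi_path_of_modified hU hφ hp1.1 hp2]
  exact mul_ne_zero h0 (hp1.2 v).ne'

/-- In both cases of its definition, `h` at `(x, ∫₀ᵘ E)` is `H(u)`. The case `u = 1` concerns the
image of `mapE`; all `u` together trace a path back to `(x, 0)`. -/
lemma mem_reachableSet_of_modified (hU : IsOpen U) (hφ : ContDiffOn ℝ ∞ φ U) {p : Fields}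
    (hp : p ∈ modifiedSolutions U φ) (u : unitInterval) :
    ((path p.1 0, primitive Plane p.2 u) : Phase) ∈ reachableSet U φ := by
  obtain ⟨hp1, hp2⟩ := (mem_modifiedSolutions_iff hU hφ p).1 hp
  have hxf := path_of_modified hp2 u
  refine ⟨⟨hp1.1 0, hxf ▸ hp1.1 u, ?_⟩, ?_⟩
  · by_cases h0 : φ (path p.1 0) = 0
    · rw [hFun_of_eq_zero h0, ← linHC_of_eq_zero hU hφ hp1.1 hp2 h0]
      exact hp1.2 u
    · rw [hFun_of_ne_zero h0, ← hxf, phi_path_of_modified hU hφ hp1.1 hp2,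
        mul_div_cancel_left₀ _ h0]
      exact hp1.2 u
  · by_cases h0 : φ (path p.1 0) = 0
    · exact Or.inl h0
    · rw [← hxf]
      exact Or.inr (path_mem_leaf hU hφ hp h0 u)

/-- The pair `(X, E)` determined by a curve `X` and a nonzero value `a` of `φ(X(0))`. -/
def curveField (a : ℝ) (X : C1) : Fields := (X, (-a⁻¹) • rotC (dpath X))

lemma curveField_eq {a : ℝ} (ha : a ≠ 0) {p : Fields} (h : dpath p.1 = a • rotC p.2) :
    curveField a p.1 = p := by
  refine Prod.ext rfl (ContinuousMap.ext fun u => ?_)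
  simp only [curveField, h, map_smul, ContinuousMap.smul_apply, rotC_apply, rot_apply]
  ext <;> simp [ha]

/-- Linearity in the curve: straight homotopies of curves become segments of fields. -/
lemma curveField_add_smul_sub (a : ℝ) (X Y : C1) (s : ℝ) :
    curveField a X + s • (curveField a Y - curveField a X) = curveField a (X + s • (Y - X)) := by
  refine Prod.ext rfl ?_
  change (-a⁻¹) • rotC (dpath X) + s • ((-a⁻¹) • rotC (dpath Y) - (-a⁻¹) • rotC (dpath X)) =
    (-a⁻¹) • rotC (dpath X + s • (dpath Y - dpath X))
  rw [map_add, map_smul, map_sub, smul_add, ← smul_sub, smul_comm s]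

lemma dpath_curveField {a : ℝ} (ha : a ≠ 0) (X : C1) :
    dpath (curveField a X).1 = a • rotC (curveField a X).2 := by
  refine ContinuousMap.ext fun u => ?_
  simp only [curveField, map_smul, ContinuousMap.smul_apply, rotC_apply, rot_apply]
  ext <;> simp [ha]

/-- Positivity of `H` is automatic here: `H = φ(X) / φ(x)`, and `φ` has constant sign on a leaf. -/
lemma curveField_mem (hU : IsOpen U) (hφ : ContDiffOn ℝ ∞ φ U) {x : Plane}
    (hx : x ∈ regularSet U φ) {X : C1} (hX : path X ∈ valuesIn unitInterval (symplecticLeaf U φ x))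
    (hX0 : path X 0 = x) : curveField (φ x) X ∈ modifiedSolutions U φ := by
  have h1 : curveField (φ x) X ∈ fieldsIn U := fun u =>
    (leaf_subset_regularSet hU hφ hx (hX u)).1
  have h2 : dpath (curveField (φ x) X).1 =
      φ (path (curveField (φ x) X).1 0) • rotC (curveField (φ x) X).2 := by
    have h3 := dpath_curveField hx.2 X
    have h4 : path (curveField (φ x) X).1 0 = x := hX0
    rw [h4]
    exact h3
  refine (mem_modifiedSolutions_iff hU hφ _).2 ⟨⟨h1, fun u => ?_⟩, h2⟩
  have h3 := phi_path_of_modified hU hφ h1 h2 u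
  have h4 : path (curveField (φ x) X).1 0 = x := hX0
  rw [h4] at h3
  have h5 := div_pos_of_mem_leaf hU hφ hx (hX u)
  change φ (path X u) = _ at h3
  rwa [h3, mul_div_cancel_left₀ _ hx.2] at h5

lemma mapE_eq (p : Fields) : mapE p = (path p.1 0, integralL p.2) := rfl

lemma integralL_eq_primitive (E : C0) : integralL E = primitive Plane E 1 := rfl

lemma path_one_of_modified {p : Fields} (h : dpath p.1 = φ (path p.1 0) • rotC p.2) :
    path p.1 1 = xf φ (mapE p) := path_of_modified h 1

lemma eq_of_xf_eq {x π π' : Plane} (h0 : φ x ≠ 0) (h : xf φ (x, π) = xf φ (x, π')) : π = π' := by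
  rw [xf_eq, xf_eq] at h
  have h1 := smul_right_injective Plane h0 (add_left_cancel h)
  simp only [rot_apply, Prod.mk.injEq, neg_inj] at h1
  exact Prod.ext h1.2 h1.1

/-- The segment from `p` to `q` consists of solutions of the modified equations with the same
initial point and the same integral. -/
def SegmentIn (U : Set Plane) (φ : Plane → ℝ) (p q : Fields) : Prop :=
  mapE p = mapE q ∧ ∀ s ∈ Icc (0 : ℝ) 1, p + s • (q - p) ∈ modifiedSolutions U φ

lemma rateC_add_smul_sub (X : C1) (E E' : C0) (s : ℝ) :
    rateC φ (X, E + s • (E' - E)) = rateC φ (X, E) + s • (rateC φ (X, E') - rateC φ (X, E)) := by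
  simp only [rateC, map_add, map_smul, map_sub]

lemma linHC_add_smul_sub (X : C1) (E E' : C0) (s : ℝ) :
    linHC φ (X, E + s • (E' - E)) = linHC φ (X, E) + s • (linHC φ (X, E') - linHC φ (X, E)) := by
  simp only [linHC, rateC_add_smul_sub, map_add, map_smul, map_sub, add_sub_add_left_eq_sub]
  abel

/-- Both curves are constant at the same point. For fixed `X`, `H` is affine in `E`, so its
positivity is a convex condition. -/
lemma segmentIn_of_eq_zero (hU : IsOpen U) (hφ : ContDiffOn ℝ ∞ φ U) {p q : Fields}
    (hp : p ∈ modifiedSolutions U φ) (hq : q ∈ modifiedSolutions U φ) (h : mapE p = mapE q)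
    (h0 : φ (path p.1 0) = 0) : SegmentIn U φ p q := by
  refine ⟨h, fun s hs => ?_⟩
  obtain ⟨hp1, hp2⟩ := (mem_modifiedSolutions_iff hU hφ p).1 hp
  obtain ⟨hq1, hq2⟩ := (mem_modifiedSolutions_iff hU hφ q).1 hq
  have hpq : path p.1 0 = path q.1 0 := congrArg Prod.fst h
  rw [h0, zero_smul] at hp2
  rw [← hpq, h0, zero_smul] at hq2
  have hX : p.1 = q.1 := C1.ext' hpq (hp2.trans hq2.symm)
  have hz : p + s • (q - p) = (p.1, p.2 + s • (q.2 - p.2)) := by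
    refine Prod.ext ?_ rfl
    simp [hX]
  rw [hz]
  refine (mem_modifiedSolutions_iff hU hφ _).2 ⟨⟨hp1.1, fun u => ?_⟩, ?_⟩
  · rw [linHC_add_smul_sub]
    refine (convex_Ioi (0 : ℝ)).add_smul_sub_mem (hp1.2 u) ?_ hs
    rw [hX]
    exact hq1.2 u
  · change dpath p.1 = φ (path p.1 0) • _
    rw [h0, zero_smul, hp2]

/-- Solutions with the same initial point and integral are joined by finitely many segments. -/
theorem eq_of_segments (hU : IsOpen U) (hφ : ContDiffOn ℝ ∞ φ U)
    (hleaf : ∀ x ∈ U, SimplyConnectedSpace (symplecticLeaf U φ x)) {β : Type} (c : Fields → β)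
    (hc : ∀ p q, SegmentIn U φ p q → c p = c q) {p q : Fields}
    (hp : p ∈ modifiedSolutions U φ) (hq : q ∈ modifiedSolutions U φ) (h : mapE p = mapE q) :
    c p = c q := by
  by_cases h0 : φ (path p.1 0) = 0
  · exact hc p q (segmentIn_of_eq_zero hU hφ hp hq h h0)
  obtain ⟨hp1, hp2⟩ := (mem_modifiedSolutions_iff hU hφ p).1 hp
  obtain ⟨hq1, hq2⟩ := (mem_modifiedSolutions_iff hU hφ q).1 hq
  have hpq : path p.1 0 = path q.1 0 := congrArg Prod.fst h
  have hqL := path_mem_leaf hU hφ hq (hpq ▸ h0)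
  have hone : path q.1 1 = path p.1 1 := by
    rw [path_one_of_modified hp2, path_one_of_modified hq2, h]
  rw [← hpq] at hq2 hqL
  have hpL := path_mem_leaf hU hφ hp h0
  generalize hx : path p.1 0 = x at *
  have hxN : x ∈ regularSet U φ := ⟨hx ▸ hp1.1 0, h0⟩
  have := hleaf x hxN.1
  rw [← curveField_eq h0 hp2, ← curveField_eq h0 hq2]
  refine eq_of_straight_homotopies (isOpen_leaf hU hφ hxN) x (path p.1 1)
    (fun X => c (curveField (φ x) X)) (fun X Y hX0 hX1 hY0 hY1 hXY => hc _ _ ?_)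
    hpL hqL hx rfl hpq.symm hone
  have hmem : ∀ s ∈ Icc (0 : ℝ) 1, curveField (φ x) X + s • (curveField (φ x) Y -
      curveField (φ x) X) ∈ modifiedSolutions U φ := fun s hs => by
    rw [curveField_add_smul_sub]
    refine curveField_mem hU hφ hxN (fun u => hXY s hs u) ?_
    change path X 0 + s • (path Y 0 - path X 0) = x
    rw [hX0, hY0, sub_self, smul_zero, add_zero]
  refine ⟨Prod.ext (hX0.trans hY0.symm) ?_, hmem⟩
  -- Since `φ x ≠ 0`, the end point determines the integral of `E`, so curves with common ends have
  -- the same image under `mapE`.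
  have e : ∀ Z : C1, path Z 0 = x → path Z 1 = xf φ (x, integralL (curveField (φ x) Z).2) :=
    fun Z hZ => by
      have h2 : path (curveField (φ x) Z).1 0 = x := hZ
      have h1 : dpath (curveField (φ x) Z).1 =
          φ (path (curveField (φ x) Z).1 0) • rotC (curveField (φ x) Z).2 := by
        rw [h2]
        exact dpath_curveField h0 Z
      have h3 := path_one_of_modified h1
      rw [mapE_eq, h2] at h3
      exact h3
  refine eq_of_xf_eq h0 ?_
  change xf φ (x, integralL (curveField (φ x) X).2) = xf φ (x, integralL (curveField (φ x) Y).2)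
  rw [← e X hX0, ← e Y hY0, hX1, hY1]

/-- A preimage of `(x, π)` is given by the constant curve with constant `E = π` if `φ x = 0`, and
otherwise by any `C¹` curve in the leaf from `x` to `x_f`. -/
lemma image_mapE (hU : IsOpen U) (hφ : ContDiffOn ℝ ∞ φ U)
    (hleaf : ∀ x ∈ U, SimplyConnectedSpace (symplecticLeaf U φ x)) :
    mapE '' modifiedSolutions U φ = reachableSet U φ := by
  ext z
  constructor
  · rintro ⟨p, hp, rfl⟩
    exact mem_reachableSet_of_modified hU hφ hp 1
  · obtain ⟨x, π⟩ := z
    rintro ⟨⟨hx, hxf, hh⟩, hz⟩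
    by_cases h0 : φ x = 0
    · have hd : dpath (mkC1 (x, 0)) = φ (path (mkC1 (x, 0)) 0) • rotC (constL Plane π) := by
        simp [h0]
      have hp : ((mkC1 (x, 0), constL Plane π) : Fields) ∈ fieldsIn U := fun u => by
        simpa using hx
      have hx0 : path (mkC1 (x, 0)) 0 = x := by simp
      refine ⟨(mkC1 (x, 0), constL Plane π), (mem_modifiedSolutions_iff hU hφ _).2
        ⟨⟨hp, fun u => ?_⟩, hd⟩, ?_⟩
      · rw [linHC_of_eq_zero hU hφ hp hd (by rw [hx0]; exact h0)]
        change 0 < 1 + fderiv ℝ φ (path (mkC1 (x, 0)) 0) (rot (primitive Plane (constL Plane π) u))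
        rw [hx0, primitive_constL, map_smul, map_smul, smul_eq_mul]
        rw [hFun_of_eq_zero h0] at hh
        have h1 := u.2.1
        have h2 := u.2.2
        change 0 < 1 + fderiv ℝ φ x (rot π) at hh
        -- Here `H(u) = 1 + u dφ(rot π)` lies between `1` and `h`, both positive.
        rcases le_or_gt 0 (fderiv ℝ φ x (rot π)) with h3 | h3
        · positivity
        · nlinarith
      · rw [mapE_eq, hx0, integralL_eq_primitive, primitive_constL]
        simp
    · have hxN : x ∈ regularSet U φ := ⟨hx, h0⟩
      have := hleaf x hx
      obtain ⟨X, hX, hX0, hX1⟩ := exists_C1_joining (isOpen_leaf hU hφ hxN) self_mem_leaf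
        (hz.resolve_left h0)
      have hmem := curveField_mem hU hφ hxN hX hX0
      refine ⟨_, hmem, Prod.ext hX0 (eq_of_xf_eq h0 ?_)⟩
      have h3 := path_one_of_modified ((mem_modifiedSolutions_iff hU hφ _).1 hmem).2
      have h4 : mapE (curveField (φ x) X) = (x, (mapE (curveField (φ x) X)).2) := Prod.ext hX0 rfl
      rw [h4] at h3
      rw [← h3, ← hX1]
      rfl

lemma isOpen_image_of_slice {S : Set Fields}
    (Ψ : OpenPartialHomeomorph Fields ((Plane × C0) × C0)) {F : Fields → Phase}
    (hS : ∀ p, p ∈ S ↔ p ∈ Ψ.source ∧ (Ψ p).2 = 0) (hne : S.Nonempty)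
    (hF : ∀ p ∈ S, F p = ((Ψ p).1.1, integralL (Ψ p).1.2)) : IsOpen (F '' S) := by
  set c := sliceChart Ψ hS hne
  have h1 : F '' S = (fun y : Plane × C0 => ((y.1, integralL y.2) : Phase)) '' c.target := by
    ext y
    constructor
    · rintro ⟨p, hp, rfl⟩
      exact ⟨c ⟨p, hp⟩, c.map_source (mem_univ _), (hF p hp).symm⟩
    · rintro ⟨z, hz, rfl⟩
      have h2 : (Ψ (c.symm z : S)).1 = z := c.right_inv hz
      exact ⟨c.symm z, (c.symm z).2, by rw [hF _ (c.symm z).2, h2]⟩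
  rw [h1]
  exact isOpenMap_phase _ c.open_target

lemma modified_slice (hU : IsOpen U) (hφ : ContDiffOn ℝ ∞ φ U) (p : Fields) :
    p ∈ modifiedSolutions U φ ↔
      p ∈ (sliceHomeo U φ hU hφ).source ∧ (sliceHomeo U φ hU hφ p).2 = 0 := by
  rw [mem_modifiedSolutions_iff hU hφ, ← sub_eq_zero]
  rfl

lemma modifiedSolutions_nonempty (hU : IsOpen U) (hφ : ContDiffOn ℝ ∞ φ U) {x : Plane}
    (hx : x ∈ U) : ((mkC1 (x, 0), 0) : Fields) ∈ modifiedSolutions U φ := by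
  have hp : ((mkC1 (x, 0), 0) : Fields) ∈ fieldsIn U := fun u => by simpa using hx
  refine (mem_modifiedSolutions_iff hU hφ _).2 ⟨⟨hp, fun u => ?_⟩, by simp⟩
  have : rateC φ (mkC1 (x, 0), 0) = 0 := by simp [rateC]
  simp [linHC, this]

/-- Openness near the zeros of `φ` is not visible from the definition; it comes from being the image
of the slice under an open map. -/
lemma isOpen_reachableSet (hU : IsOpen U) (hne : U.Nonempty) (hφ : ContDiffOn ℝ ∞ φ U)
    (hleaf : ∀ x ∈ U, SimplyConnectedSpace (symplecticLeaf U φ x)) :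
    IsOpen (reachableSet U φ) := by
  rw [← image_mapE hU hφ hleaf]
  obtain ⟨x, hx⟩ := hne
  exact isOpen_image_of_slice _ (modified_slice hU hφ) ⟨_, modifiedSolutions_nonempty hU hφ hx⟩
    fun p _ => rfl

lemma zero_mem_reachableSet (hU : IsOpen U) (hφ : ContDiffOn ℝ ∞ φ U) {x : Plane} (hx : x ∈ U) :
    ((x, 0) : Phase) ∈ reachableSet U φ := by
  have := mem_reachableSet_of_modified hU hφ (modifiedSolutions_nonempty hU hφ hx) 0
  simpa using this

/-- The path `u ↦ (x, ∫₀ᵘ E)` joins each point to the zero section, a connected copy of `U`. -/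
lemma isPreconnected_reachableSet (hU : IsOpen U) (hUc : IsConnected U) (hφ : ContDiffOn ℝ ∞ φ U)
    (hleaf : ∀ x ∈ U, SimplyConnectedSpace (symplecticLeaf U φ x)) :
    IsPreconnected (reachableSet U φ) := by
  obtain ⟨x₀, hx₀⟩ := hUc.nonempty
  refine isPreconnected_of_forall ((x₀, 0) : Phase) fun z hz => ?_
  rw [← image_mapE hU hφ hleaf] at hz
  obtain ⟨p, hp, rfl⟩ := hz
  have hp0 : path p.1 0 ∈ U := (hp 0).1
  let g : unitInterval → Phase := fun u => (path p.1 0, primitive Plane p.2 u)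
  have hg : Continuous g := continuous_const.prodMk (primitive Plane p.2).continuous
  refine ⟨(fun x : Plane => ((x, 0) : Phase)) '' U ∪ range g, union_subset ?_ ?_,
    Or.inl ⟨x₀, hx₀, rfl⟩, Or.inr ⟨1, rfl⟩, ?_⟩
  · rintro _ ⟨x, hx, rfl⟩
    exact zero_mem_reachableSet hU hφ hx
  · rintro _ ⟨u, rfl⟩
    exact mem_reachableSet_of_modified hU hφ hp u
  · refine IsPreconnected.union (path p.1 0, 0) ⟨_, hp0, rfl⟩ ⟨0, by simp [g]⟩
      (hUc.isPreconnected.image _ (by fun_prop)) (isPreconnected_range hg)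

lemma continuousOn_xf (hφ : ContDiffOn ℝ ∞ φ U) :
    ContinuousOn (xf φ) {z : Phase | z.1 ∈ U} := by
  have h : ContinuousOn (fun z : Phase => φ z.1) {z : Phase | z.1 ∈ U} :=
    hφ.continuousOn.comp continuous_fst.continuousOn fun z hz => hz
  have e : xf φ = fun z => z.1 + φ z.1 • rot z.2 := funext xf_eq
  rw [e]
  exact continuous_fst.continuousOn.add
    (h.smul (rot.continuous.comp continuous_snd).continuousOn)

/-- At a remaining point `φ(x) ≠ 0`, and `h > 0` forces `φ(x_f) ≠ 0`; thus `x` and `x_f` are regular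
points in different leaves, which is an open condition. -/
lemma exists_isOpen_compl (hU : IsOpen U) (hφ : ContDiffOn ℝ ∞ φ U) :
    ∃ V : Set Phase, IsOpen V ∧ Disjoint (reachableSet U φ) V ∧
      positiveSet U φ ⊆ reachableSet U φ ∪ V := by
  refine ⟨⋃ x ∈ regularSet U φ, {z : Phase | z.1 ∈ symplecticLeaf U φ x} ∩
    ({z : Phase | z.1 ∈ U} ∩ xf φ ⁻¹' (regularSet U φ \ symplecticLeaf U φ x)), ?_, ?_, ?_⟩
  · refine isOpen_biUnion fun x hx => ((isOpen_leaf hU hφ hx).preimage continuous_fst).inter ?_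
    exact (continuousOn_xf hφ).isOpen_inter_preimage (hU.preimage continuous_fst)
      (isOpen_diff_leaf hU hφ)
  · rw [disjoint_left]
    intro z hz hzV
    simp only [mem_iUnion, exists_prop] at hzV
    obtain ⟨x, hx, hzx, -, hzf⟩ := hzV
    rcases hz.2 with h | h
    · exact (leaf_subset_regularSet hU hφ hx hzx).2 h
    · exact hzf.2 (Relation.ReflTransGen.trans hzx h)
  · intro z hz
    by_cases h : z ∈ reachableSet U φ
    · exact Or.inl h
    · have h1 : ¬(φ z.1 = 0 ∨ xf φ z ∈ symplecticLeaf U φ z.1) := fun h2 => h ⟨hz, h2⟩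
      rw [not_or] at h1
      have h2 := hz.2.2
      rw [hFun_of_ne_zero h1.1] at h2
      refine Or.inr (mem_biUnion (x := z.1) ⟨hz.1, h1.1⟩ ⟨self_mem_leaf, hz.1,
        ⟨hz.2.1, fun h3 => ?_⟩, h1.2⟩)
      rw [h3, zero_div] at h2
      exact h2.false

lemma connectedComponentIn_positiveSet (hU : IsOpen U) (hUc : IsConnected U)
    (hφ : ContDiffOn ℝ ∞ φ U)
    (hleaf : ∀ x ∈ U, SimplyConnectedSpace (symplecticLeaf U φ x)) {x : Plane} (hx : x ∈ U) :
    connectedComponentIn (positiveSet U φ) ((x, 0) : Phase) = reachableSet U φ := by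
  have hx0 := zero_mem_reachableSet hU hφ hx
  refine Subset.antisymm ?_ ((isPreconnected_reachableSet hU hUc hφ
    hleaf).subset_connectedComponentIn hx0 fun z hz => hz.1)
  obtain ⟨V, hV, hdisj, hsub⟩ := exists_isOpen_compl hU hφ
  exact isPreconnected_connectedComponentIn.subset_left_of_subset_union
    (isOpen_reachableSet hU ⟨x, hx⟩ hφ hleaf) hV hdisj
    ((connectedComponentIn_subset _ _).trans hsub)
    ⟨(x, 0), mem_connectedComponentIn hx0.1, hx0⟩

lemma calG_eq (hU : IsOpen U) (hUc : IsConnected U) (hφ : ContDiffOn ℝ ∞ φ U)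
    (hleaf : ∀ x ∈ U, SimplyConnectedSpace (symplecticLeaf U φ x)) :
    calG U φ = reachableSet U φ := by
  refine Subset.antisymm (iUnion₂_subset fun x hx => ?_) ?_
  · rw [connectedComponentIn_positiveSet hU hUc hφ hleaf hx]
  · obtain ⟨x, hx⟩ := hUc.nonempty
    rw [← connectedComponentIn_positiveSet hU hUc hφ hleaf hx]
    exact subset_biUnion_of_mem (u := fun x => connectedComponentIn (positiveSet U φ)
      ((x, 0) : Phase)) hx

end Reachable

/-! ### First variations of the rate and of `H` -/

section Variations

lemma HasFDerivAt.comp_fields {E G : Type} [NormedAddCommGroup E] [NormedSpace ℝ E]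
    [NormedAddCommGroup G] [NormedSpace ℝ G] {g : E → G} {g' : E →L[ℝ] G} {f : Fields → E}
    {f' : Fields →L[ℝ] E} {p : Fields} (hg : HasFDerivAt g g' (f p)) (hf : HasFDerivAt f f' p) :
    HasFDerivAt (fun p => g (f p)) (g'.comp f') p :=
  _root_.HasFDerivAt.comp (E := Fields) (F := E) (G := G) p hg hf

lemma HasFDerivAt.comp_hasDerivWithinAt_fields {G : Type} [NormedAddCommGroup G]
    [NormedSpace ℝ G] {f : Fields → G} {f' : Fields →L[ℝ] G} {γ : ℝ → Fields} {v : Fields}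
    {t : Set ℝ} {s : ℝ} (hf : HasFDerivAt f f' (γ s)) (hγ : HasDerivWithinAt γ v t s) :
    HasDerivWithinAt (fun s => f (γ s)) (f' v) t s :=
  _root_.HasFDerivAt.comp_hasDerivWithinAt (E := G) (F := Fields) s hf hγ

variable {U : Set Plane} {φ : Plane → ℝ}

lemma isModifiedVariation_iff {p : Fields} {e : C1} {v : Fields} :
    IsModifiedVariation φ p e v ↔
      (∀ u, path v.1 u = φ (path p.1 0) • rot (path e u)) ∧ v.2 = dpath e := by
  constructor
  · intro h
    refine ⟨fun u => Prod.ext ?_ ?_, ContinuousMap.ext fun u => (h u).2.2⟩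
    · rw [(h u).1]
      simp
    · rw [(h u).2.1]
      simp
  · rintro ⟨h1, h2⟩ u
    refine ⟨?_, ?_, by rw [h2]⟩ <;> simp [h1 u]

/-- The area form on the plane. -/
def area (a b : Plane) : ℝ := a.1 * b.2 - a.2 * b.1

lemma isGaussVariation_iff {p : Fields} {β : C1} {v : Fields} :
    IsGaussVariation φ p β v ↔ ∀ u, path v.1 u = φ (path p.1 u) • rot (path β u) ∧
      v.2 u = dpath β u + area (p.2 u) (path β u) • (d1 φ (path p.1 u), d2 φ (path p.1 u)) := by
  refine forall_congr' fun u => ?_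
  rw [Prod.ext_iff, Prod.ext_iff]
  simp only [rot_apply, Prod.smul_fst, Prod.smul_snd, smul_eq_mul, Prod.fst_add, Prod.snd_add,
    mul_neg, area, mul_comm (d1 φ _), mul_comm (d2 φ _)]
  tauto

/-- The linear relation `ω(b,g) a + ω(a,b) g + ω(g,a) b = 0` between three vectors of the plane,
with `g = ∇φ` and `dφ(rot b) = ω(b,g)`. It trades the curvature term in `δη` and the variation of
`H` for `T β`. -/
lemma area_identity (x a b : Plane) :
    fderiv ℝ φ x (rot b) • a + area a b • (d1 φ x, d2 φ x) = fderiv ℝ φ x (rot a) • b := by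
  rw [fderiv_rot, fderiv_rot]
  ext
  · simp [area]
    ring
  · simp [area]
    ring

lemma fderiv_rot_grad (x : Plane) : fderiv ℝ φ x (rot (d1 φ x, d2 φ x)) = 0 := by
  rw [fderiv_rot]
  ring

/-- The derivative of `rateC`. -/
lemma fderiv_rateC (hU : IsOpen U) (hφ : ContDiffOn ℝ ∞ φ U) {p : Fields} (hp : p ∈ fieldsIn U)
    (v : Fields) (u : unitInterval) :
    fderiv ℝ (rateC φ) p v u =
      fderiv ℝ (fderiv ℝ φ) (path p.1 u) (path v.1 u) (rot (p.2 u)) +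
        fderiv ℝ φ (path p.1 u) (rot (v.2 u)) := by
  have hφ' : ContDiffOn ℝ ∞ (fderiv ℝ φ) U := hφ.fderiv_of_isOpen hU (by simp)
  have hpath : HasFDerivAt (fun p : Fields => path p.1) (pathL.comp
      (ContinuousLinearMap.fst ℝ C1 C0)) p := (pathL.comp
      (ContinuousLinearMap.fst ℝ C1 C0)).hasFDerivAt
  have h1 := HasFDerivAt.comp_fields (hasFDerivAt_nemytskii (K := unitInterval) hU
    (hφ'.of_le (by norm_cast)) hp) hpath
  have h2 : HasFDerivAt (fun p : Fields => rotC p.2) (rotC.comp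
      (ContinuousLinearMap.snd ℝ C1 C0)) p := (rotC.comp
      (ContinuousLinearMap.snd ℝ C1 C0)).hasFDerivAt
  have h3 := ((pointwise (K := unitInterval)
    (ContinuousLinearMap.id ℝ (Plane →L[ℝ] ℝ))).hasFDerivAt_of_bilinear (G' := Fields) h1 h2).fderiv
  have h4 : fderiv ℝ (rateC φ) p v u = _ := congrArg (fun L => L v u) h3
  rw [h4, add_comm]
  have e1 : nemytskii (fderiv ℝ (fderiv ℝ φ)) (path p.1) u =
      fderiv ℝ (fderiv ℝ φ) (path p.1 u) :=
    nemytskii_apply (hφ'.continuousOn_fderiv_of_isOpen hU (by simp)) hp u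
  have e2 : nemytskii (fderiv ℝ φ) (path p.1) u = fderiv ℝ φ (path p.1 u) :=
    nemytskii_apply hφ'.continuousOn hp u
  rw [← e1, ← e2]
  rfl

/-- The derivative of `∫ rateC` along a symmetry. -/
lemma primitive_fderiv_rateC (hU : IsOpen U) (hφ : ContDiffOn ℝ ∞ φ U) {p : Fields}
    (hp : p ∈ fieldsIn U) {e : C1} (he : path e 0 = 0) {v : Fields} (a : unitInterval → ℝ)
    (h1 : ∀ u, dpath p.1 u = a u • rot (p.2 u)) (h2 : ∀ u, path v.1 u = a u • rot (path e u))
    (h3 : ∀ u, fderiv ℝ φ (path p.1 u) (rot (v.2 u)) = fderiv ℝ φ (path p.1 u) (rot (dpath e u)))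
    (u : unitInterval) :
    primitive ℝ (fderiv ℝ (rateC φ) p v) u = fderiv ℝ φ (path p.1 u) (rot (path e u)) := by
  have hφ' : ContDiffOn ℝ ∞ (fderiv ℝ φ) U := hφ.fderiv_of_isOpen hU (by simp)
  have hd := ((derivOn_path p.1).comp hU hφ' hp).bilin
    (ContinuousLinearMap.id ℝ (Plane →L[ℝ] ℝ)) ((derivOn_path e).clm rot)
  set τ := pointwise (ContinuousLinearMap.id ℝ (Plane →L[ℝ] ℝ)) (nemytskii (fderiv ℝ φ)
    (path p.1)) (rot.compLeftContinuous ℝ unitInterval (path e)) with hτ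
  have hτu : ∀ u, τ u = fderiv ℝ φ (path p.1 u) (rot (path e u)) := fun u => by
    rw [hτ, pointwise_apply, nemytskii_apply hφ'.continuousOn hp]
    rfl
  -- The variation of the rate is the derivative in `u` of `dφ(rot e)`. As `X' = a rot E` and `δX =
  -- a rot e` share the factor `a`, symmetry of the second derivative exchanges them. Hypothesis
  -- `h3` only compares the second fields after `dφ ∘ rot`, which covers both kinds of symmetry.
  have key : fderiv ℝ (rateC φ) p v = pointwise (ContinuousLinearMap.id ℝ (Plane →L[ℝ] ℝ))
      (nemytskii (fderiv ℝ φ) (path p.1)) (rot.compLeftContinuous ℝ unitInterval (dpath e)) +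
      pointwise (ContinuousLinearMap.id ℝ (Plane →L[ℝ] ℝ))
        (pointwise (ContinuousLinearMap.id ℝ (Plane →L[ℝ] Plane →L[ℝ] ℝ))
          (nemytskii (fderiv ℝ (fderiv ℝ φ)) (path p.1)) (dpath p.1))
        (rot.compLeftContinuous ℝ unitInterval (path e)) := by
    ext u
    rw [fderiv_rateC hU hφ hp, h2, h3, ContinuousMap.add_apply, pointwise_apply, pointwise_apply,
      pointwise_apply, nemytskii_apply hφ'.continuousOn hp,
      nemytskii_apply (hφ'.continuousOn_fderiv_of_isOpen hU (by simp)) hp, h1, add_comm]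
    have hs : IsSymmSndFDerivAt ℝ φ (path p.1 u) :=
      (hφ.contDiffAt (hU.mem_nhds (hp u))).isSymmSndFDerivAt
        (by simp only [minSmoothness_of_isRCLikeNormedField]; norm_cast)
    simp only [ContinuousLinearMap.id_apply, map_smul, smul_apply]
    rw [hs.eq]
    rfl
  rw [key, ← hτu]
  have h4 := hd.eq_primitive u
  rw [hτu 0, he, rot.map_zero, ContinuousLinearMap.map_zero, zero_add] at h4
  exact h4.symm

lemma fderiv_linHC (hU : IsOpen U) (hφ : ContDiffOn ℝ ∞ φ U) {p : Fields} (hp : p ∈ fieldsIn U)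
    (v : Fields) : fderiv ℝ (linHC φ) p v = primitive ℝ (fderiv ℝ (rateC φ) p v) := by
  have h1 : HasFDerivAt (rateC φ) (fderiv ℝ (rateC φ) p) p :=
    (((contDiffOn_rateC hU hφ).differentiableOn (by simp)).differentiableAt
      ((isOpen_fieldsIn hU).mem_nhds hp)).hasFDerivAt
  have h2 := (((primitive ℝ).hasFDerivAt.comp p h1).const_add (constL ℝ 1)).fderiv
  exact congrArg (fun L => L v) h2

lemma fderiv_expHC (hU : IsOpen U) (hφ : ContDiffOn ℝ ∞ φ U) {p : Fields} (hp : p ∈ fieldsIn U)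
    (v : Fields) (u : unitInterval) : fderiv ℝ (expHC φ) p v u =
      expHC φ p u * primitive ℝ (fderiv ℝ (rateC φ) p v) u := by
  have h1 : HasFDerivAt (rateC φ) (fderiv ℝ (rateC φ) p) p :=
    (((contDiffOn_rateC hU hφ).differentiableOn (by simp)).differentiableAt
      ((isOpen_fieldsIn hU).mem_nhds hp)).hasFDerivAt
  have h0 : HasFDerivAt (expHC φ) (fderiv ℝ (expHC φ) p) p :=
    (((contDiffOn_expHC hU hφ).differentiableOn (by simp)).differentiableAt
      ((isOpen_fieldsIn hU).mem_nhds hp)).hasFDerivAt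
  have h2 : HasFDerivAt (fun p => expHC φ p u) ((evalL ℝ u).comp (fderiv ℝ (expHC φ) p)) p :=
    (evalL ℝ u).hasFDerivAt.comp p h0
  have h3 : HasFDerivAt (fun p => Real.exp (primitive ℝ (rateC φ p) u)) _ p :=
    (((evalL ℝ u).comp (primitive ℝ)).hasFDerivAt.comp p h1).exp
  have h4 : (fun p => expHC φ p u) = fun p => Real.exp (primitive ℝ (rateC φ p) u) :=
    funext fun p => expC_apply _ u
  rw [h4] at h2
  have h5 := congrArg (fun L => L v) (h2.unique h3)
  change fderiv ℝ (expHC φ) p v u = _ at h5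
  rw [h5, expHC, expC_apply]
  rfl

end Variations

/-! ### Invariance of the map to `ℝ⁴` under the symmetries -/

section Invariance

/-- `mapE` as a continuous linear map. -/
def mapEL : Fields →L[ℝ] Phase :=
  (((evalL Plane 0).comp pathL).comp (ContinuousLinearMap.fst ℝ C1 C0)).prod
    (integralL.comp (ContinuousLinearMap.snd ℝ C1 C0))

lemma eq_of_hasDerivWithinAt_zero {E : Type} [NormedAddCommGroup E] [NormedSpace ℝ E] {g : ℝ → E}
    (h : ∀ s ∈ Icc (0 : ℝ) 1, HasDerivWithinAt g 0 (Icc 0 1) s) : g 0 = g 1 := by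
  have := (convex_Icc (0 : ℝ) 1).norm_image_sub_le_of_norm_hasDerivWithin_le (C := 0)
    (f := g) (f' := fun _ => (0 : E)) h (by simp) (x := 0) (y := 1)
    ⟨le_rfl, zero_le_one⟩ ⟨zero_le_one, le_rfl⟩
  rw [zero_mul, norm_le_zero_iff, sub_eq_zero] at this
  exact this.symm

lemma integralL_of_derivOn {f f' : C0} (h : DerivOn f f') : integralL f' = f 1 - f 0 := by
  rw [h.eq_primitive 1, add_sub_cancel_left]
  rfl

variable {U : Set Plane} {φ : Plane → ℝ}

/-- The velocity of `mapE` along the arc is zero: `δX(0)` is proportional to `rot e(0)`, and `∫ e' =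
e(1) - e(0)`. -/
lemma mapE_eq_of_modifiedArc {p q : modifiedSolutions U φ}
    (h : SymmetryArc (modifiedSolutions U φ) (IsModifiedVariation φ) p q) :
    mapE p = mapE q := by
  obtain ⟨γ, β, h0, h1, -, hγ⟩ := h
  rw [← h0, ← h1]
  refine eq_of_hasDerivWithinAt_zero (g := fun s => mapE (γ s)) fun s hs => ?_
  obtain ⟨-, hβ0, hβ1, v, hv, hvar⟩ := hγ s hs
  rw [isModifiedVariation_iff] at hvar
  have h2 : HasDerivWithinAt (fun s => mapE (γ s)) (mapEL v) (Icc 0 1) s :=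
    HasFDerivAt.comp_hasDerivWithinAt_fields mapEL.hasFDerivAt hv
  have h3 : mapEL v = 0 := by
    refine Prod.ext ?_ ?_
    · change path v.1 0 = 0
      rw [hvar.1, hβ0, rot.map_zero, smul_zero]
    · change integralL v.2 = 0
      rw [hvar.2, integralL_of_derivOn (derivOn_path _), hβ0, hβ1, sub_zero]
  rwa [h3] at h2

lemma hasFDerivAt_toE (hU : IsOpen U) (hφ : ContDiffOn ℝ ∞ φ U) {p : Fields}
    (hp : p ∈ fieldsIn U) : HasFDerivAt (toE φ) (fderiv ℝ (toE φ) p) p :=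
  (((contDiffOn_toE hU hφ).differentiableOn (by simp)).differentiableAt
    ((isOpen_fieldsIn hU).mem_nhds hp)).hasFDerivAt

lemma fderiv_toE_fst (hU : IsOpen U) (hφ : ContDiffOn ℝ ∞ φ U) {p : Fields}
    (hp : p ∈ fieldsIn U) (v : Fields) : (fderiv ℝ (toE φ) p v).1 = v.1 := by
  have h1 : HasFDerivAt (fun p => (toE φ p).1) ((ContinuousLinearMap.fst ℝ C1 C0).comp
      (fderiv ℝ (toE φ) p)) p :=
    HasFDerivAt.comp_fields (E := Fields) (G := C1) (ContinuousLinearMap.fst ℝ C1 C0).hasFDerivAt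
      (hasFDerivAt_toE hU hφ hp)
  have h2 : HasFDerivAt (fun p : Fields => p.1) (ContinuousLinearMap.fst ℝ C1 C0) p :=
    (ContinuousLinearMap.fst ℝ C1 C0).hasFDerivAt
  exact congrArg (fun L => L v) (h1.unique h2)

lemma fderiv_toE_snd (hU : IsOpen U) (hφ : ContDiffOn ℝ ∞ φ U) {p : Fields}
    (hp : p ∈ fieldsIn U) (v : Fields) (u : unitInterval) : (fderiv ℝ (toE φ) p v).2 u =
      expHC φ p u • v.2 u + fderiv ℝ (expHC φ) p v u • p.2 u := by
  have h0 : HasFDerivAt (expHC φ) (fderiv ℝ (expHC φ) p) p :=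
    (((contDiffOn_expHC hU hφ).differentiableOn (by simp)).differentiableAt
      ((isOpen_fieldsIn hU).mem_nhds hp)).hasFDerivAt
  have h1 : HasFDerivAt (fun p => (toE φ p).2 u) (((evalL Plane u).comp
      (ContinuousLinearMap.snd ℝ C1 C0)).comp (fderiv ℝ (toE φ) p)) p :=
    HasFDerivAt.comp_fields (E := Fields) ((evalL Plane u).comp
      (ContinuousLinearMap.snd ℝ C1 C0)).hasFDerivAt (hasFDerivAt_toE hU hφ hp)
  have h2 : HasFDerivAt (fun p => expHC φ p u) ((evalL ℝ u).comp (fderiv ℝ (expHC φ) p)) p :=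
    (evalL ℝ u).hasFDerivAt.comp p h0
  have h3 : HasFDerivAt (fun p : Fields => p.2 u) ((evalL Plane u).comp
      (ContinuousLinearMap.snd ℝ C1 C0)) p :=
    ((evalL Plane u).comp (ContinuousLinearMap.snd ℝ C1 C0)).hasFDerivAt
  have h5 : HasFDerivAt (fun p : Fields => expHC φ p u • p.2 u) _ p :=
    (ContinuousLinearMap.lsmul ℝ ℝ).hasFDerivAt_of_bilinear (F := Plane) (G' := Fields) h2 h3
  have h4 := congrArg (fun L => L v) (HasFDerivAt.unique (E := Fields) h1 h5)
  simpa using h4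

/-- The variation of `E = H η` under a gauge symmetry with generator `β` is `(H β)'`. -/
lemma fderiv_toE_snd_of_variation (hU : IsOpen U) (hφ : ContDiffOn ℝ ∞ φ U) {p : Fields}
    (hp : p ∈ gaussSolutions U φ) {β : C1} (hβ : path β 0 = 0) {v : Fields}
    (hv : IsGaussVariation φ p β v) : (fderiv ℝ (toE φ) p v).2 =
      scale Plane (expHC φ p) (dpath β) +
        scale Plane (scale ℝ (expHC φ p) (rateC φ p)) (path β) := by
  obtain ⟨hp1, hp2⟩ := (mem_gaussSolutions_iff p).1 hp
  rw [isGaussVariation_iff] at hv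
  ext1 u
  rw [fderiv_toE_snd hU hφ hp1, fderiv_expHC hU hφ hp1,
    primitive_fderiv_rateC hU hφ hp1 hβ (fun u => φ (path p.1 u)) hp2 (fun u => (hv u).1)
    (fun u => by rw [(hv u).2, map_add, map_add, map_smul, map_smul, fderiv_rot_grad,
      smul_zero, add_zero]), (hv u).2]
  -- After division by `H` the variation of `E` is `β' + ω(η,β) ∇φ + dφ(rot β) η`; the last two
  -- terms combine to `T β`.
  have h1 := area_identity (φ := φ) (path p.1 u) (p.2 u) (path β u)
  simp only [ContinuousMap.add_apply, scale_apply]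
  rw [rateC_apply_fderiv hU hφ hp1, smul_eq_mul, mul_smul, mul_smul, ← smul_add, ← smul_add, ← h1]
  congr 1
  abel

/-- The variation of `E` is `(H β)'`, whose integral vanishes because `β` does at both ends. -/
lemma mapE_toE_eq_of_gaussArc (hU : IsOpen U) (hφ : ContDiffOn ℝ ∞ φ U) {p q : gaussSolutions U φ}
    (h : SymmetryArc (gaussSolutions U φ) (IsGaussVariation φ) p q) :
    mapE (toE φ p) = mapE (toE φ q) := by
  obtain ⟨γ, β, h0, h1, -, hγ⟩ := h
  rw [← h0, ← h1]
  refine eq_of_hasDerivWithinAt_zero (g := fun s => mapE (toE φ (γ s))) fun s hs => ?_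
  obtain ⟨hmem, hβ0, hβ1, v, hv, hvar⟩ := hγ s hs
  have hp1 := ((mem_gaussSolutions_iff _).1 hmem).1
  have h2 : HasDerivWithinAt (fun s => mapE (toE φ (γ s))) (mapEL (fderiv ℝ (toE φ) (γ s) v))
      (Icc 0 1) s := by
    have h4 : HasFDerivAt (fun p => mapEL (toE φ p)) (mapEL.comp (fderiv ℝ (toE φ) (γ s))) (γ s) :=
      HasFDerivAt.comp_fields (E := Fields) mapEL.hasFDerivAt (hasFDerivAt_toE hU hφ hp1)
    have h5 := HasFDerivAt.comp_hasDerivWithinAt_fields h4 hv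
    exact h5
  have h3 : mapEL (fderiv ℝ (toE φ) (γ s) v) = 0 := by
    refine Prod.ext ?_ ?_
    · change path (fderiv ℝ (toE φ) (γ s) v).1 0 = 0
      rw [fderiv_toE_fst hU hφ hp1, (isGaussVariation_iff.1 hvar 0).1, hβ0, rot.map_zero, smul_zero]
    · change integralL (fderiv ℝ (toE φ) (γ s) v).2 = 0
      rw [fderiv_toE_snd_of_variation hU hφ hmem hβ0 hvar]
      have h4 : DerivOn (scale Plane (expHC φ (γ s)) (path (β s))) _ :=
        (derivOn_expHC (γ s)).bilin (ContinuousLinearMap.lsmul ℝ ℝ) (derivOn_path (β s))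
      refine (integralL_of_derivOn h4).trans ?_
      simp [hβ0, hβ1]
  rwa [h3] at h2

end Invariance

/-! ### Segments of solutions as symmetry arcs -/

section Arcs

variable {U : Set Plane} {φ : Plane → ℝ}

lemma DerivOn.inv {f f' : C(unitInterval, ℝ)} (hf : f ∈ valuesIn unitInterval (Ioi (0 : ℝ)))
    (h : DerivOn f f') : DerivOn (invC f) (-scale ℝ (scale ℝ (invC f) (invC f)) f') := by
  have h1 := h.comp isOpen_Ioi contDiffOn_inv_Ioi hf
  have e : -scale ℝ (scale ℝ (invC f) (invC f)) f' = pointwise (ContinuousLinearMap.id ℝ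
      (ℝ →L[ℝ] ℝ)) (nemytskii (fderiv ℝ fun x : ℝ => x⁻¹) f) f' := by
    ext u
    rw [pointwise_apply, nemytskii_apply (contDiffOn_inv_Ioi.continuousOn_fderiv_of_isOpen
      isOpen_Ioi (by simp)) hf, fderiv_inv]
    simp [invC_apply hf]
    ring
  rw [e]
  exact h1

/-- The generator `β = H⁻¹ e`. -/
def gaussGenerator (φ : Plane → ℝ) (e : C1) (σ : Fields) : C1 :=
  mkC1 (0, scale Plane (invC (linHC φ σ)) (dpath e) + scale Plane (-scale ℝ (scale ℝ
    (invC (linHC φ σ)) (invC (linHC φ σ))) (rateC φ σ)) (path e))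

/-- The generator was prescribed through its derivative, by the product rule, and the starting value
`0`; this is consistent because `e(0) = 0`. -/
lemma path_gaussGenerator {e : C1} (he : path e 0 = 0) {σ : Fields}
    (hσ : linHC φ σ ∈ valuesIn unitInterval (Ioi (0 : ℝ))) (u : unitInterval) :
    path (gaussGenerator φ e σ) u = (linHC φ σ u)⁻¹ • path e u := by
  have h1 : DerivOn (scale Plane (invC (linHC φ σ)) (path e)) _ :=
    ((derivOn_linHC σ).inv hσ).bilin (ContinuousLinearMap.lsmul ℝ ℝ) (derivOn_path e)
  have h2 := h1.eq_primitive u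
  rw [scale_apply, scale_apply, he, smul_zero, invC_apply hσ] at h2
  rw [h2]
  rfl

lemma continuousOn_gaussGenerator (hU : IsOpen U) (hφ : ContDiffOn ℝ ∞ φ U) (e : C1) :
    ContinuousOn (gaussGenerator φ e) (positiveFields U φ) := by
  have hr : ContinuousOn (rateC φ) (positiveFields U φ) :=
    (contDiffOn_rateC hU hφ).continuousOn.mono inter_subset_left
  have hk : ContinuousOn (fun σ => invC (linHC φ σ)) (positiveFields U φ) :=
    contDiffOn_invC.continuousOn.comp
      ((contDiffOn_linHC hU hφ).continuousOn.mono inter_subset_left) fun p hp => hp.2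
  have hkk : ContinuousOn (fun σ => scale ℝ (invC (linHC φ σ)) (invC (linHC φ σ)))
      (positiveFields U φ) := ((scale ℝ).continuous.comp_continuousOn hk).clm_apply hk
  have h3 : ContinuousOn (fun σ => -scale ℝ (scale ℝ (invC (linHC φ σ)) (invC (linHC φ σ)))
      (rateC φ σ)) (positiveFields U φ) :=
    (((scale ℝ).continuous.comp_continuousOn hkk).clm_apply hr).neg
  have h4 : ContinuousOn (fun σ => scale Plane (invC (linHC φ σ)) (dpath e))
      (positiveFields U φ) :=
    ((scale Plane).continuous.comp_continuousOn hk).clm_apply continuousOn_const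
  have h5 : ContinuousOn (fun σ => scale Plane (-scale ℝ (scale ℝ (invC (linHC φ σ))
      (invC (linHC φ σ))) (rateC φ σ)) (path e)) (positiveFields U φ) :=
    ((scale Plane).continuous.comp_continuousOn h3).clm_apply continuousOn_const
  exact contDiff_mkC1.continuous.comp_continuousOn (continuousOn_const.prodMk (h4.add h5))

lemma hasFDerivAt_toEta (hU : IsOpen U) (hφ : ContDiffOn ℝ ∞ φ U) {σ : Fields}
    (hσ : σ ∈ positiveFields U φ) : HasFDerivAt (toEta φ) (fderiv ℝ (toEta φ) σ) σ :=
  (((contDiffOn_toEta hU hφ).differentiableOn (by simp)).differentiableAt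
    ((isOpen_positiveFields hU hφ).mem_nhds hσ)).hasFDerivAt

lemma fderiv_toEta_fst (hU : IsOpen U) (hφ : ContDiffOn ℝ ∞ φ U) {σ : Fields}
    (hσ : σ ∈ positiveFields U φ) (v : Fields) : (fderiv ℝ (toEta φ) σ v).1 = v.1 := by
  have h1 : HasFDerivAt (fun p => (toEta φ p).1) ((ContinuousLinearMap.fst ℝ C1 C0).comp
      (fderiv ℝ (toEta φ) σ)) σ :=
    HasFDerivAt.comp_fields (E := Fields) (G := C1) (ContinuousLinearMap.fst ℝ C1 C0).hasFDerivAt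
      (hasFDerivAt_toEta hU hφ hσ)
  have h2 : HasFDerivAt (fun p : Fields => p.1) (ContinuousLinearMap.fst ℝ C1 C0) σ :=
    (ContinuousLinearMap.fst ℝ C1 C0).hasFDerivAt
  exact congrArg (fun L => L v) (h1.unique h2)

lemma linHC_smul_toEta {σ : Fields} (hσ : σ ∈ positiveFields U φ) (u : unitInterval) :
    linHC φ σ u • (toEta φ σ).2 u = σ.2 u := by
  change linHC φ σ u • (invC (linHC φ σ) u • σ.2 u) = σ.2 u
  rw [invC_apply hσ.2, smul_smul, mul_inv_cancel₀ (hσ.2 u).ne', one_smul]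

/-- Differentiating the identity `H η = E` avoids differentiating `H⁻¹`. -/
lemma fderiv_toEta_snd (hU : IsOpen U) (hφ : ContDiffOn ℝ ∞ φ U) {σ : Fields}
    (hσ : σ ∈ positiveFields U φ) (v : Fields) (u : unitInterval) :
    linHC φ σ u • (fderiv ℝ (toEta φ) σ v).2 u + fderiv ℝ (linHC φ) σ v u • (toEta φ σ).2 u =
      v.2 u := by
  have h0 : HasFDerivAt (linHC φ) (fderiv ℝ (linHC φ) σ) σ :=
    (((contDiffOn_linHC hU hφ).differentiableOn (by simp)).differentiableAt
      ((isOpen_fieldsIn hU).mem_nhds hσ.1)).hasFDerivAt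
  have h1 : HasFDerivAt (fun p => (toEta φ p).2 u) (((evalL Plane u).comp
      (ContinuousLinearMap.snd ℝ C1 C0)).comp (fderiv ℝ (toEta φ) σ)) σ :=
    HasFDerivAt.comp_fields (E := Fields) ((evalL Plane u).comp
      (ContinuousLinearMap.snd ℝ C1 C0)).hasFDerivAt (hasFDerivAt_toEta hU hφ hσ)
  have h2 : HasFDerivAt (fun p => linHC φ p u) ((evalL ℝ u).comp (fderiv ℝ (linHC φ) σ)) σ :=
    (evalL ℝ u).hasFDerivAt.comp σ h0
  have h3 : HasFDerivAt (fun p : Fields => p.2 u) ((evalL Plane u).comp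
      (ContinuousLinearMap.snd ℝ C1 C0)) σ :=
    ((evalL Plane u).comp (ContinuousLinearMap.snd ℝ C1 C0)).hasFDerivAt
  have h5 : HasFDerivAt (fun p : Fields => linHC φ p u • (toEta φ p).2 u) _ σ :=
    (ContinuousLinearMap.lsmul ℝ ℝ).hasFDerivAt_of_bilinear (F := Plane) (G' := Fields) h2 h1
  have h6 : (fun p : Fields => linHC φ p u • (toEta φ p).2 u) =ᶠ[𝓝 σ] fun p => p.2 u := by
    filter_upwards [(isOpen_positiveFields hU hφ).mem_nhds hσ] with p hp
    exact linHC_smul_toEta hp u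
  have h7 : HasFDerivAt (fun p : Fields => linHC φ p u • (toEta φ p).2 u) ((evalL Plane u).comp
      (ContinuousLinearMap.snd ℝ C1 C0)) σ := HasFDerivAt.congr_of_eventuallyEq h3 h6
  have h4 := congrArg (fun L => L v) (HasFDerivAt.unique (E := Fields) h5 h7)
  simpa using h4

/-- For `X`: `φ(X) H⁻¹ = φ(X(0))`. For `η`: since `δH = dφ(rot e)`, one has `H δη = e' - dφ(rot e)
η`, which `area_identity` matches with the required form for `β = H⁻¹ e`. -/
lemma isGaussVariation_toEta (hU : IsOpen U) (hφ : ContDiffOn ℝ ∞ φ U) {σ : Fields}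
    (hσ : σ ∈ modifiedSolutions U φ) {e : C1} (he : path e 0 = 0) {v : Fields}
    (hv : IsModifiedVariation φ σ e v) :
    IsGaussVariation φ (toEta φ σ) (gaussGenerator φ e σ) (fderiv ℝ (toEta φ) σ v) := by
  obtain ⟨hσ1, hσ2⟩ := (mem_modifiedSolutions_iff hU hφ σ).1 hσ
  rw [isModifiedVariation_iff] at hv
  rw [isGaussVariation_iff]
  intro u
  have hH : linHC φ σ u ≠ 0 := (hσ1.2 u).ne'
  have hβ := path_gaussGenerator he hσ1.2 u
  constructor
  · rw [fderiv_toEta_fst hU hφ hσ1, hv.1, hβ]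
    change _ = φ (path σ.1 u) • _
    rw [phi_path_of_modified hU hφ hσ1.1 hσ2 u, map_smul, smul_smul, mul_assoc, mul_inv_cancel₀ hH,
      mul_one]
  · have h1 := fderiv_toEta_snd hU hφ hσ1 v u
    rw [fderiv_linHC hU hφ hσ1.1, primitive_fderiv_rateC hU hφ hσ1.1 he
      (fun _ => φ (path σ.1 0)) (fun u => by rw [hσ2]; rfl) hv.1 (fun u => by rw [hv.2]),
      hv.2] at h1
    have h2 := area_identity (φ := φ) (path σ.1 u) ((toEta φ σ).2 u)
      (path (gaussGenerator φ e σ) u)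
    have h3 : rateC φ σ u = linHC φ σ u * fderiv ℝ φ (path σ.1 u) (rot ((toEta φ σ).2 u)) := by
      rw [rateC_apply_fderiv hU hφ hσ1.1, ← linHC_smul_toEta hσ1 u, map_smul, map_smul,
        smul_eq_mul]
    have h4 : dpath (gaussGenerator φ e σ) u = (linHC φ σ u)⁻¹ • dpath e u +
        (-((linHC φ σ u)⁻¹ * (linHC φ σ u)⁻¹ * rateC φ σ u)) • path e u := by
      rw [← invC_apply hσ1.2]
      rfl
    change _ = _ + area ((toEta φ σ).2 u) (path (gaussGenerator φ e σ) u) •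
      (d1 φ (path σ.1 u), d2 φ (path σ.1 u))
    rw [← eq_sub_iff_add_eq'] at h2
    rw [← eq_sub_iff_add_eq] at h1
    refine smul_right_injective Plane hH ?_
    change linHC φ σ u • (fderiv ℝ (toEta φ) σ v).2 u = linHC φ σ u • _
    rw [h1, h2, h4, h3, hβ, map_smul, map_smul, smul_eq_mul]
    generalize fderiv ℝ φ (path σ.1 u) (rot (path e u)) = τ
    generalize fderiv ℝ φ (path σ.1 u) (rot ((toEta φ σ).2 u)) = T
    generalize linHC φ σ u = H at hH
    ext
    · simp
      field_simp
      ring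
    · simp
      field_simp
      ring

variable {p q : Fields}

/-- The constant velocity along a segment of solutions is a symmetry. -/
lemma SegmentIn.isModifiedVariation (hU : IsOpen U) (hφ : ContDiffOn ℝ ∞ φ U)
    (h : SegmentIn U φ p q) (s : ℝ) :
    IsModifiedVariation φ (p + s • (q - p)) (mkC1 (0, q.2 - p.2)) (q - p) := by
  have hp : p ∈ modifiedSolutions U φ := by simpa using h.2 0 (by simp)
  have hq : q ∈ modifiedSolutions U φ := by simpa using h.2 1 (by simp)
  have hp2 := ((mem_modifiedSolutions_iff hU hφ p).1 hp).2
  have hq2 := ((mem_modifiedSolutions_iff hU hφ q).1 hq).2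
  have hpq : path p.1 0 = path q.1 0 := congrArg Prod.fst h.1
  rw [isModifiedVariation_iff]
  refine ⟨fun u => ?_, rfl⟩
  have h0 : path (p + s • (q - p)).1 0 = path p.1 0 := by
    change path p.1 0 + s • (path q.1 0 - path p.1 0) = path p.1 0
    rw [hpq, sub_self, smul_zero, add_zero]
  rw [h0]
  change path q.1 u - path p.1 u = _
  rw [path_of_modified hp2, path_of_modified hq2, ← hpq, xf_eq, xf_eq, add_sub_add_left_eq_sub,
    ← smul_sub, path_mkC1, zero_add]
  change φ (path p.1 0) • (rot (primitive Plane q.2 u) - rot (primitive Plane p.2 u)) =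
    φ (path p.1 0) • rot (primitive Plane (q.2 - p.2) u)
  rw [← map_sub, map_sub (primitive Plane)]
  rfl

lemma SegmentIn.path_generator_one (h : SegmentIn U φ p q) :
    path (mkC1 (0, q.2 - p.2)) 1 = 0 := by
  have h1 : integralL p.2 = integralL q.2 := congrArg Prod.snd h.1
  rw [path_mkC1, zero_add]
  change integralL (q.2 - p.2) = 0
  rw [map_sub, h1, sub_self]

lemma hasDerivWithinAt_segment {E : Type} [NormedAddCommGroup E] [NormedSpace ℝ E] (p q : E)
    (s : ℝ) : HasDerivWithinAt (fun s : ℝ => p + s • (q - p)) (q - p) (Icc 0 1) s := by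
  have h1 := ((hasDerivAt_id s).smul_const (q - p)).const_add p
  rw [one_smul] at h1
  exact h1.hasDerivWithinAt

lemma SegmentIn.modifiedArc (hU : IsOpen U) (hφ : ContDiffOn ℝ ∞ φ U) (h : SegmentIn U φ p q)
    (hp : p ∈ modifiedSolutions U φ) (hq : q ∈ modifiedSolutions U φ) :
    SymmetryArc (modifiedSolutions U φ) (IsModifiedVariation φ) ⟨p, hp⟩ ⟨q, hq⟩ :=
  ⟨fun s => p + s • (q - p), fun _ => mkC1 (0, q.2 - p.2), by simp, by simp, continuousOn_const,
    fun s hs => ⟨h.2 s hs, by simp, h.path_generator_one, _, hasDerivWithinAt_segment (E := Fields) p q s,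
      h.isModifiedVariation hU hφ s⟩⟩

lemma toEta_mem (hU : IsOpen U) (hφ : ContDiffOn ℝ ∞ φ U) (hp : p ∈ modifiedSolutions U φ) :
    toEta φ p ∈ gaussSolutions U φ := by
  have hp1 := ((mem_modifiedSolutions_iff hU hφ p).1 hp).1
  refine (toE_mem_iff hU hφ (p := toEta φ p) hp1.1).1 ?_
  have : toE φ (toEta φ p) = p := (toEHomeo U φ hU hφ).right_inv hp1
  rwa [this]

/-- The segment is transported by `toEta`. The generator `H⁻¹ e` now depends on `s` through `H`,
continuously. -/
lemma SegmentIn.gaussArc (hU : IsOpen U) (hφ : ContDiffOn ℝ ∞ φ U) (h : SegmentIn U φ p q)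
    (hp : p ∈ modifiedSolutions U φ) (hq : q ∈ modifiedSolutions U φ) :
    SymmetryArc (gaussSolutions U φ) (IsGaussVariation φ) ⟨toEta φ p, toEta_mem hU hφ hp⟩
      ⟨toEta φ q, toEta_mem hU hφ hq⟩ := by
  have hpos : ∀ s ∈ Icc (0 : ℝ) 1, p + s • (q - p) ∈ positiveFields U φ := fun s hs =>
    ((mem_modifiedSolutions_iff hU hφ _).1 (h.2 s hs)).1
  have hcont : Continuous fun s : ℝ => p + s • (q - p) :=
    continuous_const.add (continuous_id.smul continuous_const)
  refine ⟨fun s => toEta φ (p + s • (q - p)),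
    fun s => gaussGenerator φ (mkC1 (0, q.2 - p.2)) (p + s • (q - p)), by simp, by simp,
    (continuousOn_gaussGenerator hU hφ _).comp hcont.continuousOn hpos, fun s hs => ?_⟩
  refine ⟨toEta_mem hU hφ (h.2 s hs), ?_, ?_, _,
    HasFDerivAt.comp_hasDerivWithinAt_fields (G := Fields)
      (hasFDerivAt_toEta hU hφ (hpos s hs)) (hasDerivWithinAt_segment (E := Fields) p q s),
    isGaussVariation_toEta hU hφ (h.2 s hs) (by simp) (h.isModifiedVariation hU hφ s)⟩
  · rw [path_gaussGenerator (by simp) (hpos s hs).2, path_mkC1]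
    simp
  · rw [path_gaussGenerator (by simp) (hpos s hs).2, h.path_generator_one, smul_zero]

end Arcs

/-! ### The two quotients -/

section Main

variable {U : Set Plane} {φ : Plane → ℝ}

lemma mapEta_eq (hU : IsOpen U) (hφ : ContDiffOn ℝ ∞ φ U) {p : Fields} (hp : p ∈ fieldsIn U) :
    mapEta φ p = mapE (toE φ p) := by
  refine Prod.ext rfl (intervalIntegral.integral_congr fun u hu => ?_)
  rw [uIcc_of_le (zero_le_one' ℝ)] at hu
  change expH φ p u • IccExtend _ p.2 u = IccExtend _ (scale Plane (expHC φ p) p.2) u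
  rw [IccExtend_of_mem _ _ hu, IccExtend_of_mem _ _ hu, scale_apply, expHC_apply hU hφ hp]

theorem diffeomorphicVia_modified (hU : IsOpen U) (hUc : IsConnected U) (hφ : ContDiffOn ℝ ∞ φ U)
    (hleaf : ∀ x ∈ U, SimplyConnectedSpace (symplecticLeaf U φ x))
    (hG : IsOpen (calG U φ)) :
    DiffeomorphicVia (modifiedSolutions U φ) (IsModifiedVariation φ) ⟨calG U φ, hG⟩ mapE := by
  classical
  obtain ⟨x, hx⟩ := hUc.nonempty
  refine diffeomorphicVia_of_slice (sliceHomeo U φ hU hφ)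
    ((contDiffOn_toSlice hφ).mono inter_subset_left)
    ((contDiffOn_ofSlice hφ).mono inter_subset_left) (modified_slice hU hφ)
    ⟨_, modifiedSolutions_nonempty hU hφ hx⟩ (fun p _ => rfl) ?_
    (fun p q => mapE_eq_of_modifiedArc) fun p q hpq => ?_
  · rw [image_mapE hU hφ hleaf]
    exact (calG_eq hU hUc hφ hleaf).symm
  -- The class map, extended by `none` to all fields, is constant along segments; hence it takes
  -- equal values wherever `mapE` does.
  · let c : Fields → Option (PhaseSpace (modifiedSolutions U φ) (IsModifiedVariation φ)) :=
      fun p => if h : p ∈ modifiedSolutions U φ then some (Quot.mk _ ⟨p, h⟩) else none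
    have h1 := eq_of_segments hU hφ hleaf c (fun p q h => ?_) p.2 q.2 hpq
    · simpa [c] using h1
    · have hp : p ∈ modifiedSolutions U φ := by simpa using h.2 0 (by simp)
      have hq : q ∈ modifiedSolutions U φ := by simpa using h.2 1 (by simp)
      simp only [c, dif_pos hp, dif_pos hq]
      exact congrArg some (Quot.sound (h.modifiedArc hU hφ hp hq))

theorem diffeomorphicVia_gauss (hU : IsOpen U) (hUc : IsConnected U) (hφ : ContDiffOn ℝ ∞ φ U)
    (hleaf : ∀ x ∈ U, SimplyConnectedSpace (symplecticLeaf U φ x))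
    (hG : IsOpen (calG U φ)) :
    DiffeomorphicVia (gaussSolutions U φ) (IsGaussVariation φ) ⟨calG U φ, hG⟩ (mapEta φ) := by
  classical
  obtain ⟨x, hx⟩ := hUc.nonempty
  have hin : ∀ p ∈ gaussSolutions U φ, p ∈ fieldsIn U := fun p hp =>
    ((mem_gaussSolutions_iff p).1 hp).1
  have hF : ∀ p ∈ gaussSolutions U φ, mapEta φ p = mapE (toE φ p) := fun p hp =>
    mapEta_eq hU hφ (hin p hp)
  have hleft : ∀ p ∈ gaussSolutions U φ, toEta φ (toE φ p) = p := fun p hp =>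
    (toEHomeo U φ hU hφ).left_inv (hin p hp)
  have hright : ∀ p ∈ modifiedSolutions U φ, toE φ (toEta φ p) = p := fun p hp =>
    (toEHomeo U φ hU hφ).right_inv ((mem_modifiedSolutions_iff hU hφ p).1 hp).1
  have hmem : ∀ p ∈ gaussSolutions U φ, toE φ p ∈ modifiedSolutions U φ := fun p hp =>
    (toE_mem_iff hU hφ (hin p hp)).2 hp
  -- The slice chart is that of the modified equations pulled back along `E = H η`.
  refine diffeomorphicVia_of_slice ((toEHomeo U φ hU hφ).trans (sliceHomeo U φ hU hφ))
    ?_ ?_ (fun p => ?_) ⟨_, toEta_mem hU hφ (modifiedSolutions_nonempty hU hφ hx)⟩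
    (fun p hp => hF p hp) ?_ (fun p q h => ?_) fun p q hpq => ?_
  · exact (contDiffOn_toSlice hφ).comp ((contDiffOn_toE hU hφ).mono inter_subset_left)
      fun p hp => hp.2.1
  · exact (contDiffOn_toEta hU hφ).comp ((contDiffOn_ofSlice hφ).mono fun z hz => hz.1.1)
      fun z hz => hz.2
  · constructor
    · intro hp
      have h1 := (modified_slice hU hφ _).1 (hmem p hp)
      exact ⟨⟨hin p hp, h1.1⟩, h1.2⟩
    · rintro ⟨⟨h1, h2⟩, h3⟩
      exact (toE_mem_iff hU hφ h1).1 ((modified_slice hU hφ _).2 ⟨h2, h3⟩)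
  · change _ = calG U φ
    rw [calG_eq hU hUc hφ hleaf, ← image_mapE hU hφ hleaf]
    ext z
    constructor
    · rintro ⟨p, hp, rfl⟩
      exact ⟨_, hmem p hp, (hF p hp).symm⟩
    · rintro ⟨p, hp, rfl⟩
      have h1 := toEta_mem hU hφ hp
      exact ⟨_, h1, by rw [hF _ h1, hright p hp]⟩
  · rw [hF p p.2, hF q q.2]
    exact mapE_toE_eq_of_gaussArc hU hφ h
  · rw [hF p p.2, hF q q.2] at hpq
    -- Segments live on the `E` side, so `c` takes the class of the field transported back by
    -- `toEta`.
    let c : Fields → Option (PhaseSpace (gaussSolutions U φ) (IsGaussVariation φ)) :=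
      fun p => if h : toEta φ p ∈ gaussSolutions U φ then some (Quot.mk _ ⟨toEta φ p, h⟩) else none
    have h1 := eq_of_segments hU hφ hleaf c (fun p q h => ?_) (hmem p p.2) (hmem q q.2) hpq
    · simpa [c, hleft p p.2, hleft q q.2] using h1
    · have hp : p ∈ modifiedSolutions U φ := by simpa using h.2 0 (by simp)
      have hq : q ∈ modifiedSolutions U φ := by simpa using h.2 1 (by simp)
      simp only [c, dif_pos (toEta_mem hU hφ hp), dif_pos (toEta_mem hU hφ hq)]
      exact congrArg some (Quot.sound (h.gaussArc hU hφ hp hq))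

end Main

end PoissonSigma

end

open PoissonSigma
theorem mainTheorem3 (U : Set Plane) (hU : IsOpen U) (hUc : IsConnected U)
    (φ : Plane → ℝ) (hφ : ContDiffOn ℝ ∞ φ U)
    (hleaf : ∀ x ∈ U, SimplyConnectedSpace (symplecticLeaf U φ x)) :
    (∀ x ∈ U, ((x, 0) : Phase) ∈ calG U φ ∧
      connectedComponentIn (positiveSet U φ) (x, 0) = calG U φ) ∧
    ∃ hG : IsOpen (calG U φ),
      DiffeomorphicVia (gaussSolutions U φ) (IsGaussVariation φ) ⟨calG U φ, hG⟩ (mapEta φ) ∧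
      DiffeomorphicVia (modifiedSolutions U φ) (IsModifiedVariation φ) ⟨calG U φ, hG⟩ mapE := by
  have hcalG := calG_eq hU hUc hφ hleaf
  have hG : IsOpen (calG U φ) := by
    rw [hcalG]
    exact isOpen_reachableSet hU hUc.nonempty hφ hleaf
  refine ⟨fun x hx => ⟨?_, ?_⟩, hG, diffeomorphicVia_gauss hU hUc hφ hleaf hG,
    diffeomorphicVia_modified hU hUc hφ hleaf hG⟩
  · rw [hcalG]
    exact zero_mem_reachableSet hU hφ hx
  · rw [hcalG, connectedComponentIn_positiveSet hU hUc hφ hleaf hx]
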